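/- **Setting.** Consider $N\ge 2$ clocks with sampling period $\tau>0$, an undirected connected communication graph $\mathcal G$ with Laplacian $\mathcal L$, and states $x_i[k]\in\mathbb R^2$ (phase, frequency), $$x_i[k+1]=Ax_i[k]+Bu_i[k]+v_i[k],\qquad h_i[k]=Cx_i[k],\qquad A=\begin{bmatrix}1&\tau\\0&1\end{bmatrix},\; B=\begin{bmatrix}\tau\\1\end{bmatrix},\; C=[\,1\ \ 0\,],\qquad k=0,1,2,\dots$$ The measurements on the directed sub-edges $(i,j)$ (both directions of every edge) are $y_{ij}[k]=h_j[k]-h_i[k]+w_{ij}[k]$. The noises $v_i[k]$ (for all $i,k$) and $w_{ij}[k]$ (for all $(i,j),k$) are zero-mean Gaussian and mutually independent; $w_{ij}[k]$ has variance $R>0$ and $v_i[k]$ has covariance $$Q_i=\begin{bmatrix}\tau\sigma_{i1}^2+\frac{\tau^3}{3}\sigma_{i2}^2&\frac{\tau^2}{2}\sigma_{i2}^2\\ \frac{\tau^2}{2}\sigma_{i2}^2&\tau\sigma_{i2}^2\end{bmatrix},\qquad \sigma_{i1},\sigma_{i2}>0.$$ Stacked vectors list all phases first, then all frequencies; $x$,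 $v$ are the stacked $x_i$, $v_i$, and $\mathbf Q$ is the covariance of $v[k]$. Put $\Gamma(t)=\mathrm{diag}\big(t\sigma_{i1}^2+\tfrac{t^3}{3}\sigma_{i2}^2\big)_i$. Let $T=\ell\tau$ with an integer $\ell\ge1$. For $q\in\mathbb R^N$ with $q^{\sf T}\mathbf 1=1$ let $\Phi(q)$ be the free-running dynamics $r[k+1]=Ar[k]+(I_2\otimes q^{\sf T})v[k]$ with output $h_r=Cr$; let $q_\tau$ and $q_T$ be the $q$ which minimize, over all $q$ with $q^{\sf T}\mathbf 1=1$, the Allan variance $\mathbb E\big[(h_r[k+2m]-2h_r[k+m]+h_r[k])^2\big]/(2(m\tau)^2)$ of $\Phi(q)$ for $m=1$ and for $m=\ell$, respectively. For a family of sub-edges with incidence matrix $V$ (the row of $(i,j)$ is $e_j^{\sf T}-e_i^{\sf T}$) the edge states are $\zeta=(I_2\otimes V)x$, $\zeta_{ij}=x_j-x_i$, and their estimator is $\hat\zeta[k+1]=(A\otimes I)\hat\zeta[k]+(B\otimes I)V\eta[k]+H\big(y[k]-(C\otimes I)\hat\zeta[k]\big)$, where $y$ collects the measurements of the family and $H$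 is a steady-state Kalman gain: $H=\mathbf A P\mathbf C^{\sf T}(\mathbf C P\mathbf C^{\sf T}+RI)^{-1}$ with $P\succeq0$ and $P=\mathbf AP\mathbf A^{\sf T}-\mathbf AP\mathbf C^{\sf T}(\mathbf CP\mathbf C^{\sf T}+RI)^{-1}\mathbf CP\mathbf A^{\sf T}+(I_2\otimes V)\mathbf Q(I_2\otimes V^{\sf T})$, $\mathbf A=A\otimes I$, $\mathbf C=C\otimes I$. Here $\eta$ is the synchronization control below. *Synchronization.* Clock $i$ runs such an estimator on its sub-edges $(i,j)$, $j$ a neighbour of $i$. With $D=\Gamma(\tau)$, $$\eta_i[k]=D_iF_s\sum_{j\sim i}\Big(\hat\zeta_{ij}[k]-\tfrac12\big(\hat\zeta_{ij}[k]+\hat\zeta_{ji}[k]\big)\Big),\quad F_s=\gamma_s\big[\tfrac{\alpha_s}{\tau}\ \ 1\big],\quad \alpha_s>0,\quad 0<\gamma_s<\tfrac{4}{2+\alpha_s}\lambda_{\max}^{-1}\big(D^{1/2}\mathcal LD^{1/2}\big).$$ *Floating.* A supervisor runs such an estimator, with state $\hat\zeta_\beta$, gain $H_f$ and measurements $y_\beta$,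 on the $N-1$ sub-edges of a directed spanning tree with incidence matrix $V_\beta$. Let $V_{\beta T}^+=W(V_\beta W)^{-1}$, where $q_T^{\sf T}W=0$ and $V_\beta W$ is invertible, let $M=I_2\otimes q_\tau^{\sf T}V_{\beta T}^+$, and let $$\hat{\bar z}^-_T[k+1]=A\hat{\bar z}^-_T[k]+B\bar\eta[k]+MH_f\big(y_\beta[k]-(C\otimes I)\hat\zeta_\beta[k]\big),\qquad \bar\eta[k]=\begin{cases}-F_f\,\hat{\bar z}^-_T[k],&\ell\mid k,\\0,&\text{otherwise,}\end{cases}\qquad F_f=\gamma_f\big[\tfrac{\alpha_f}{T}\ \ 1\big],$$ with $\gamma_f,\alpha_f\in\mathbb R$. The input of clock $i$ is $u_i[k]=\eta_i[k]+\bar\eta[k]$. Initial values of the clocks and estimators are arbitrary constants. Let $r$ be the trajectory of $\Phi(q_T)$ with $r[0]=(I_2\otimes q_T^{\sf T})x[0]+\big(M\hat\zeta_\beta[0]-\hat{\bar z}^-_T[0]\big)$; the bracket is zero if the supervisor's two estimators are initialized consistently. A process $Y[K]$, $K\ge0$, is said to be in $\mathbb G$ (in steady state stationary Gaussian with zero mean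 and bounded variance) if it is Gaussian, $\mathbb E\,Y[K]\to0$ as $K\to\infty$, and for every lag $m\ge0$ the covariance of $Y[K]$ and $Y[K+m]$ converges to a finite limit as $K\to\infty$. **Theorem.** The following are equivalent: 1. for all initial values, $\{x_i[K\ell]-r[K\ell]\}_{K\ge0}\in\mathbb G$ for every clock $i$; 2. $0<\gamma_f<\dfrac{4}{2+\alpha_f}$ and $\alpha_f>0$. Moreover, if $q_\tau\ne q_T$, then for each single choice of the initial values, $\{x_i[K\ell]-r[K\ell]\}_{K\ge0}\in\mathbb G$ for every clock $i$ if and only if condition 2 holds. -/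

import Mathlib

open MeasureTheory ProbabilityTheory Filter Topology Matrix
open scoped Kronecker

noncomputable section

/-! ### Clock model -/

/-- The system matrix `A` of a two-state clock with sampling period `τ`. -/
def clockA (τ : ℝ) : Matrix (Fin 2) (Fin 2) ℝ := !![1, τ; 0, 1]

/-- The input vector `B` of a clock. -/
def clockB (τ : ℝ) : Fin 2 → ℝ := ![τ, 1]

/-- The output row `C` of a clock: only the phase is read. -/
def clockC : Fin 2 → ℝ := ![1, 0]

/-- The noise covariance `Q_i(τ)` of one clock, where `s₁`, `s₂` are the standard deviations of the
white frequency noise and of the random walk frequency noise. -/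
def clockQ (τ s₁ s₂ : ℝ) : Matrix (Fin 2) (Fin 2) ℝ :=
  !![τ * s₁ ^ 2 + τ ^ 3 / 3 * s₂ ^ 2, τ ^ 2 / 2 * s₂ ^ 2; τ ^ 2 / 2 * s₂ ^ 2, τ * s₂ ^ 2]

/-- `A ⊗ I`, acting on stacked states: the index `(a, j)` is the `a`-th state (`0` is the phase,
`1` the frequency) of the `j`-th component. -/
def stackA (τ : ℝ) (m : Type*) [DecidableEq m] : Matrix (Fin 2 × m) (Fin 2 × m) ℝ :=
  clockA τ ⊗ₖ (1 : Matrix m m ℝ)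

/-- `B ⊗ I`. -/
def stackB (τ : ℝ) (m : Type*) [DecidableEq m] : Matrix (Fin 2 × m) m ℝ :=
  Matrix.of fun p j => clockB τ p.1 * (1 : Matrix m m ℝ) p.2 j

/-- `C ⊗ I`. -/
def stackC (m : Type*) [DecidableEq m] : Matrix m (Fin 2 × m) ℝ :=
  Matrix.of fun j p => clockC p.1 * (1 : Matrix m m ℝ) j p.2

/-- `(I₂ ⊗ qᵀ) s`. -/
def weighted {m : Type*} [Fintype m] (q : m → ℝ) (s : Fin 2 × m → ℝ) : Fin 2 → ℝ :=
  fun a => ∑ j, q j * s (a, j)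

/-- The gain row `γ [α / T, 1]`. -/
def gainRow (γ α T : ℝ) : Fin 2 → ℝ := γ • ![α / T, 1]

/-- `H` is a steady-state Kalman gain for state matrix `A`, output matrix `C`, process noise
covariance `Q` and measurement noise covariance `R`; here `P` is the steady prediction error
covariance. -/
def IsSteadyKalmanGain {n m : Type*} [Fintype n] [Fintype m] [DecidableEq m]
    (A : Matrix n n ℝ) (C : Matrix m n ℝ) (Q : Matrix n n ℝ) (R : Matrix m m ℝ)
    (H : Matrix n m ℝ) : Prop :=
  ∃ P : Matrix n n ℝ, P.PosSemidef ∧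
    P = A * P * Aᵀ - A * P * Cᵀ * (C * P * Cᵀ + R)⁻¹ * C * P * Aᵀ + Q ∧
    H = A * P * Cᵀ * (C * P * Cᵀ + R)⁻¹

/-- `Vp = W (V W)⁻¹` for some `W` with `qᵀ W = 0` and `V W` invertible: the generalized inverse of
`V` induced by `q`. -/
def IsInducedInverse {m n : Type*} [Fintype m] [DecidableEq m] [Fintype n]
    (q : n → ℝ) (V : Matrix m n ℝ) (Vp : Matrix n m ℝ) : Prop :=
  ∃ W : Matrix n m ℝ, q ᵥ* W = 0 ∧ IsUnit (V * W).det ∧ Vp = W * (V * W)⁻¹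

/-- The largest eigenvalue of a real symmetric matrix. -/
def lambdaMax {n : Type*} [Fintype n] [DecidableEq n] (M : Matrix n n ℝ) : ℝ :=
  sSup (spectrum ℝ M)

/-- The class of processes which, in steady state, are stationary Gaussian with zero mean and
bounded variance, for a process `Y` started at time `0`: `Y` is Gaussian, its mean tends to zero,
and its covariance at every lag tends to a (finite) limit which depends only on the lag. For a
Gaussian process this says that the finite-dimensional laws of the time-shifted process converge to
those of a centred stationary Gaussian process. -/
structure IsSteadyStationaryGaussian {Ω : Type*} [MeasurableSpace Ω] (μ : Measure Ω)
    (Y : ℕ → Ω → Fin 2 → ℝ) : Prop where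
  gaussian : IsGaussianProcess (fun (t : ℕ × Fin 2) ω => Y t.1 ω t.2) μ
  mean : ∀ a, Tendsto (fun K => ∫ ω, Y K ω a ∂μ) atTop (𝓝 0)
  cov : ∃ c : ℕ → Fin 2 → Fin 2 → ℝ, ∀ m a b,
    Tendsto (fun K => cov[fun ω => Y K ω a, fun ω => Y (K + m) ω b; μ]) atTop (𝓝 (c m a b))

/-- An ensemble of `N` clocks with a connected communication graph. -/
structure ClockEnsemble (N : ℕ) where
  /-- sampling period -/
  τ : ℝ
  τ_pos : 0 < τ
  /-- standard deviations of the white frequency noises -/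
  σ₁ : Fin N → ℝ
  σ₁_pos : ∀ i, 0 < σ₁ i
  /-- standard deviations of the random walk frequency noises -/
  σ₂ : Fin N → ℝ
  σ₂_pos : ∀ i, 0 < σ₂ i
  /-- variance of the measurement noises -/
  R : ℝ
  R_pos : 0 < R
  /-- communication network -/
  graph : SimpleGraph (Fin N)
  connected : graph.Connected

namespace ClockEnsemble

variable {N : ℕ} (E : ClockEnsemble N)

instance : DecidableRel E.graph.Adj := Classical.decRel _

/-- The covariance matrix `𝐐(τ)` of the stacked process noise. -/
def Q : Matrix (Fin 2 × Fin N) (Fin 2 × Fin N) ℝ :=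
  Matrix.of fun p q => if p.2 = q.2 then clockQ E.τ (E.σ₁ p.2) (E.σ₂ p.2) p.1 q.1 else 0

/-- The diagonal of `Γ(T) = T Σ₁ + (T³ / 3) Σ₂`. -/
def Γ (T : ℝ) (i : Fin N) : ℝ := T * E.σ₁ i ^ 2 + T ^ 3 / 3 * E.σ₂ i ^ 2

/-- Process noise `v[k]` and measurement noise `w[k]`: jointly Gaussian, centred and white, where
`v[k]` has covariance `𝐐(τ)`, the noise `w_{ij}[k]` on each directed sub-edge `(i, j)` has variance
`R`, and different measurement noises as well as process and measurement noise are uncorrelated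
(hence, being jointly Gaussian, independent). -/
structure IsNoise {Ω : Type*} [MeasurableSpace Ω] (μ : Measure Ω)
    (v : ℕ → Ω → Fin 2 × Fin N → ℝ) (w : ℕ → Ω → E.graph.Dart → ℝ) : Prop where
  gaussian : IsGaussianProcess
    (fun (t : ℕ × ((Fin 2 × Fin N) ⊕ E.graph.Dart)) ω => Sum.elim (v t.1 ω) (w t.1 ω) t.2) μ
  mean_v : ∀ k p, ∫ ω, v k ω p ∂μ = 0
  mean_w : ∀ k d, ∫ ω, w k ω d ∂μ = 0
  cov_v : ∀ k l p q, cov[fun ω => v k ω p, fun ω => v l ω q; μ] = if k = l then E.Q p q else 0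
  cov_w : ∀ k l d d', cov[fun ω => w k ω d, fun ω => w l ω d'; μ] =
    if k = l ∧ d = d' then E.R else 0
  cov_vw : ∀ k l p d, cov[fun ω => v k ω p, fun ω => w l ω d; μ] = 0

/-! ### Free-running ensemble mean and Allan variance -/

/-- The trajectory of the free-running dynamics `Φ(q)` started at `r₀`:
`r[k+1] = A r[k] + (I₂ ⊗ qᵀ) v[k]`. -/
def freeRun {Ω : Type*} (v : ℕ → Ω → Fin 2 × Fin N → ℝ) (q : Fin N → ℝ) (r₀ : Fin 2 → ℝ) :
    ℕ → Ω → Fin 2 → ℝ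
  | 0, _ => r₀
  | k + 1, ω => clockA E.τ *ᵥ freeRun v q r₀ k ω + weighted q (v k ω)

/-- The Allan variance over the averaging time `m τ`, evaluated at time `k`, of the output of the
free-running dynamics `Φ(q)` started at `r₀`. -/
def allanVar {Ω : Type*} [MeasurableSpace Ω] (μ : Measure Ω) (v : ℕ → Ω → Fin 2 × Fin N → ℝ)
    (q : Fin N → ℝ) (r₀ : Fin 2 → ℝ) (m k : ℕ) : ℝ :=
  let h : ℕ → Ω → ℝ := fun l ω => clockC ⬝ᵥ E.freeRun v q r₀ l ω
  ∫ ω, ((h (k + 2 * m) ω - h (k + m) ω) - (h (k + m) ω - h k ω)) ^ 2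
    / (2 * ((m : ℝ) * E.τ) ^ 2) ∂μ

/-- `q` is the weighting vector `q_A(m τ)` of the ensemble mean with the least Allan variance over
the averaging time `m τ`. -/
def IsAllanOptimal {Ω : Type*} [MeasurableSpace Ω] (μ : Measure Ω)
    (v : ℕ → Ω → Fin 2 × Fin N → ℝ) (m : ℕ) (q : Fin N → ℝ) : Prop :=
  ∑ i, q i = 1 ∧ ∀ q' : Fin N → ℝ, ∑ i, q' i = 1 →
    ∀ (r₀ : Fin 2 → ℝ) (k : ℕ), E.allanVar μ v q r₀ m k ≤ E.allanVar μ v q' r₀ m k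

/-! ### Edges, measurements and estimators -/

/-- The neighbours of clock `i`. -/
abbrev Nbr (i : Fin N) : Type := {j : Fin N // E.graph.Adj i j}

/-- The sub-edge `(i, j)`, which carries the edge state `ζ_{ij} = x_j - x_i`, for a neighbour `j`
of `i`. -/
def nbrDart (i : Fin N) (j : E.Nbr i) : E.graph.Dart := ⟨(i, j.1), j.2⟩

variable {E} in
/-- The incidence matrix of a family of sub-edges: the row of `(i, j)` is `e_jᵀ - e_iᵀ`. -/
def incidence {m : Type} (d : m → E.graph.Dart) : Matrix m (Fin N) ℝ :=
  Matrix.of fun e n => (if n = (d e).snd then 1 else 0) - (if n = (d e).fst then 1 else 0)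

variable {E} in
/-- The covariance `(I₂ ⊗ V) 𝐐(τ) (I₂ ⊗ Vᵀ)` of the process noise of a family of edge states. -/
def edgeQ {m : Type} [DecidableEq m] (d : m → E.graph.Dart) :
    Matrix (Fin 2 × m) (Fin 2 × m) ℝ :=
  ((1 : Matrix (Fin 2) (Fin 2) ℝ) ⊗ₖ incidence d) * E.Q *
    ((1 : Matrix (Fin 2) (Fin 2) ℝ) ⊗ₖ incidence d)ᵀ

variable {E} in
/-- `H` is the steady-state Kalman gain of the estimator for the edge states of the family `d`. -/
def IsEdgeKalmanGain {m : Type} [Fintype m] [DecidableEq m] (d : m → E.graph.Dart)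
    (H : Matrix (Fin 2 × m) m ℝ) : Prop :=
  IsSteadyKalmanGain (stackA E.τ m) (stackC m) (edgeQ d) (E.R • (1 : Matrix m m ℝ)) H

variable {E} in
/-- The measured time differences `y_{ij} = h_j - h_i + w_{ij}` along the sub-edges of a family. -/
def measurement {m : Type} (d : m → E.graph.Dart) (x : Fin 2 × Fin N → ℝ)
    (w : E.graph.Dart → ℝ) : m → ℝ :=
  fun e => (clockC ⬝ᵥ fun a => x (a, (d e).snd)) - (clockC ⬝ᵥ fun a => x (a, (d e).fst)) + w (d e)

variable {E} in
/-- The innovation `y - (C ⊗ I) ζ̂` of an edge-state estimator. -/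
def innovation {m : Type} [Fintype m] [DecidableEq m] (d : m → E.graph.Dart)
    (ζ : Fin 2 × m → ℝ) (x : Fin 2 × Fin N → ℝ) (w : E.graph.Dart → ℝ) : m → ℝ :=
  measurement d x w - stackC m *ᵥ ζ

variable {E} in
/-- One step of an edge-state estimator:
`ζ̂⁺ = (A ⊗ I) ζ̂ + (B ⊗ I) V η + H (y - (C ⊗ I) ζ̂)`. -/
def estimatorStep {m : Type} [Fintype m] [DecidableEq m] (d : m → E.graph.Dart)
    (H : Matrix (Fin 2 × m) m ℝ) (ζ : Fin 2 × m → ℝ) (x : Fin 2 × Fin N → ℝ)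
    (η : Fin N → ℝ) (w : E.graph.Dart → ℝ) : Fin 2 × m → ℝ :=
  stackA E.τ m *ᵥ ζ + stackB E.τ m *ᵥ (incidence d *ᵥ η) + H *ᵥ innovation d ζ x w

/-- A directed spanning tree of the network: `N - 1` sub-edges whose underlying edges form a tree
on all clocks. -/
structure SpanningTree where
  edge : Fin (N - 1) → E.graph.Dart
  isTree : (SimpleGraph.fromEdgeSet (Set.range fun e => (edge e).edge)).IsTree

/-! ### The controlled ensemble -/

/-- The data of the synchronization and floating controllers. -/
structure Controller where
  /-- the long control period is `T = ℓ τ` -/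
  ℓ : ℕ
  /-- weighting vector `q_τ` -/
  qτ : Fin N → ℝ
  /-- weighting vector `q_T` -/
  qT : Fin N → ℝ
  /-- parameters of the synchronization gain -/
  γs : ℝ
  αs : ℝ
  /-- parameters of the floating gain -/
  γf : ℝ
  αf : ℝ
  /-- observer gains of the local edge-state estimators -/
  H : ∀ i : Fin N, Matrix (Fin 2 × E.Nbr i) (E.Nbr i) ℝ
  /-- directed spanning tree of the supervisor -/
  tree : E.SpanningTree
  /-- generalized inverse of the incidence matrix of the tree, induced by `q_T` -/
  Vp : Matrix (Fin N) (Fin (N - 1)) ℝ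
  /-- observer gain of the estimator of the tree edge states -/
  Hf : Matrix (Fin 2 × Fin (N - 1)) (Fin (N - 1)) ℝ

/-- States of the clocks and of all estimators. -/
@[ext]
structure LoopState where
  /-- states of the clocks -/
  x : Fin 2 × Fin N → ℝ
  /-- local estimates `ζ̂_i` -/
  ζ : ∀ i : Fin N, Fin 2 × E.Nbr i → ℝ
  /-- estimate `ζ̂_β` of the edge states of the spanning tree -/
  ζβ : Fin 2 × Fin (N - 1) → ℝ
  /-- the supervisor's estimate of the gap `z̄_T⁻` -/
  zT : Fin 2 → ℝ

namespace Controller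

variable {E} (c : E.Controller)

/-- The long control period. -/
def T : ℝ := c.ℓ * E.τ

/-- The row `q_τᵀ V_β⁺`. -/
def gapRow : Fin (N - 1) → ℝ := c.qτ ᵥ* c.Vp

/-- The unbiased edge-state estimate `ζ̂_{ij}⁺ = ζ̂_{ij} - (ζ̂_{ij} + ζ̂_{ji}) / 2`. -/
def fused (s : E.LoopState) (i : Fin N) (j : E.Nbr i) : Fin 2 → ℝ :=
  fun a => s.ζ i (a, j) - (s.ζ i (a, j) + s.ζ j.1 (a, ⟨i, j.2.symm⟩)) / 2

/-- The synchronization control `η_i = D_i F_s ∑_j ζ̂_{ij}⁺` with `D = Γ(τ)` and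
`F_s = γ_s [α_s / τ, 1]`. -/
def syncInput (s : E.LoopState) (i : Fin N) : ℝ :=
  E.Γ E.τ i * (gainRow c.γs c.αs E.τ ⬝ᵥ ∑ j : E.Nbr i, fused s i j)

/-- The floating control, common to all clocks: `-F_f z̄̂_T⁻[k]` with `F_f = γ_f [α_f / T, 1]` at
the long-period instants `k ∈ ℓ ℤ`, and zero otherwise. -/
def floatInput (k : ℕ) (s : E.LoopState) : ℝ :=
  if c.ℓ ∣ k then -(gainRow c.γf c.αf c.T ⬝ᵥ s.zT) else 0

/-- One step of the closed loop at time `k`. The control applied to clock `i` is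
`syncInput s i + floatInput k s`. -/
def step (k : ℕ) (s : E.LoopState) (v : Fin 2 × Fin N → ℝ) (w : E.graph.Dart → ℝ) :
    E.LoopState where
  x := stackA E.τ (Fin N) *ᵥ s.x
    + stackB E.τ (Fin N) *ᵥ (fun i => c.syncInput s i + c.floatInput k s) + v
  ζ := fun i => estimatorStep (E.nbrDart i) (c.H i) (s.ζ i) s.x (c.syncInput s) w
  ζβ := estimatorStep c.tree.edge c.Hf s.ζβ s.x (c.syncInput s) w
  zT := clockA E.τ *ᵥ s.zT + c.floatInput k s • clockB E.τ
    + weighted c.gapRow (c.Hf *ᵥ innovation c.tree.edge s.ζβ s.x w)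

/-- The closed loop started at `s₀`. -/
def loop {Ω : Type*} (v : ℕ → Ω → Fin 2 × Fin N → ℝ) (w : ℕ → Ω → E.graph.Dart → ℝ)
    (s₀ : E.LoopState) : ℕ → Ω → E.LoopState
  | 0, _ => s₀
  | k + 1, ω => c.step k (loop v w s₀ k ω) (v k ω) (w k ω)

/-- Initial state of the reference `Φ(q_T)`: the `q_T`-weighted mean of the initial clock states,
corrected by the mismatch `(I₂ ⊗ q_τᵀ V_β⁺) ζ̂_β[0] - z̄̂_T⁻[0]` of the initial values of the
supervisor's two estimators, which vanishes if they are initialized consistently. -/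
def refInit (s₀ : E.LoopState) : Fin 2 → ℝ :=
  weighted c.qT s₀.x + (weighted c.gapRow s₀.ζβ - s₀.zT)

/-- Every clock follows `r` up to a process which is stationary Gaussian with zero mean and bounded
variance in steady state, along the long-period instants `k ∈ ℓ ℤ`, where `r` is the trajectory
of `Φ(q_T)`. -/
def Tracks {Ω : Type*} [MeasurableSpace Ω] (μ : Measure Ω) (v : ℕ → Ω → Fin 2 × Fin N → ℝ)
    (w : ℕ → Ω → E.graph.Dart → ℝ) (s₀ : E.LoopState) : Prop :=
  ∀ i : Fin N, IsSteadyStationaryGaussian μ fun K ω a =>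
    (c.loop v w s₀ (K * c.ℓ) ω).x (a, i) - E.freeRun v c.qT (c.refInit s₀) (K * c.ℓ) ω a

end Controller

/-- `D^{1/2} L D^{1/2}` with `D = Γ(τ)` and `L` the Laplacian of the network. -/
def scaledLaplacian : Matrix (Fin N) (Fin N) ℝ :=
  Matrix.diagonal (fun i => √(E.Γ E.τ i)) * E.graph.lapMatrix ℝ *
    Matrix.diagonal (fun i => √(E.Γ E.τ i))

end ClockEnsemble

end

/-! The tracking error of a clock is a linear output of error coordinates: the deviations from the
`q_τ`-mean, the estimation errors on all edges, and the supervisor's estimate of the gap. The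
reference can be eliminated because the `q_T`-mean and the reference receive the same process noise,
and their difference is always the gap estimate minus the gap computed from the estimated tree edges
(`weighted_sub_freeRun`, `loop_sub_freeRun`). The error coordinates obey a linear recursion,
periodic with period `ℓ` and driven by white noise.

This recursion is a cascade. The estimation errors are autonomous and decay, since the Riccati
solution is a Lyapunov function when the edge noise is nondegenerate (`IsSteadyKalmanGain.stable`).
They drive the deviations, which decouple along eigenvectors of the scaled Laplacian into clocks
under static feedback (`modeCoord_syncStep`). The zero mode drops out because the minimizer `q_τ` is
proportional to `Γ(τ)⁻¹` (`IsAllanOptimal.eq`), which is the mean that synchronization leaves alone.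
The tree errors drive the gap estimate, whose map over one long period is `feedbackMatrix γf αf T`
(`backwardFlow_floatStep_period`). Condition 2 is exactly the stability of this matrix, by Jury's
criterion.

For sufficiency, a stable monodromy makes the impulse responses summable, so the tracking error is a
moving average of white noise whose covariances converge. For necessity, convergent means and
variances force the initial response and all impulse responses to vanish
(`tendsto_zero_of_isSteadyStationaryGaussian`). When the initial values are free, starting from a
gap estimate alone exposes the gap map. For one fixed initial value, the noise does this: process
and measurement noise can be balanced so that only the gap estimate is excited among the
supervisor's errors. If `q_τ ≠ q_T`, the Kalman gain lets the kick reach the frequency component,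
and kicks at two phases of the long period span the plane. -/

noncomputable section

/-! ### Periodic linear systems -/

section LinearSystems

variable {E : Type*} [NormedAddCommGroup E] [NormedSpace ℝ E]

/-- The `i`-step transition map ending at a multiple of the period, for a system whose step map at
time `-k` is that at time `k`. -/
def backwardFlow (A : ℕ → E →ₗ[ℝ] E) : ℕ → E →ₗ[ℝ] E
  | 0 => LinearMap.id
  | i + 1 => backwardFlow A i ∘ₗ A (i + 1)

theorem backwardFlow_const (A : E →ₗ[ℝ] E) (i : ℕ) : backwardFlow (fun _ => A) i = A ^ i := by
  induction i with
  | zero => rfl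
  | succ i ih => rw [backwardFlow, ih, pow_succ]; rfl

theorem backwardFlow_add {A : ℕ → E →ₗ[ℝ] E} {l : ℕ} (hA : ∀ i, A (i + l) = A i) (i : ℕ) :
    backwardFlow A (i + l) = backwardFlow A l ∘ₗ backwardFlow A i := by
  induction i with
  | zero => simp [backwardFlow]
  | succ i ih =>
    rw [show i + 1 + l = (i + l) + 1 by ring, backwardFlow, backwardFlow, ih,
      show i + l + 1 = (i + 1) + l by ring, hA, LinearMap.comp_assoc]

theorem backwardFlow_mul_add {A : ℕ → E →ₗ[ℝ] E} {l : ℕ} (hA : ∀ i, A (i + l) = A i) (K i : ℕ) :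
    backwardFlow A (K * l + i) = backwardFlow A l ^ K * backwardFlow A i := by
  induction K with
  | zero => simp
  | succ K ih =>
    rw [show (K + 1) * l + i = (K * l + i) + l by ring, backwardFlow_add hA, ih, pow_succ']
    rfl

theorem backwardFlow_mul {A : ℕ → E →ₗ[ℝ] E} {l : ℕ} (hA : ∀ i, A (i + l) = A i) (K : ℕ) :
    backwardFlow A (K * l) = backwardFlow A l ^ K := by
  have := backwardFlow_mul_add hA K 0
  rwa [add_zero, backwardFlow, ← Module.End.one_eq_id, mul_one] at this

/-- Variation of constants, unrolled backwards from time `n`. The reflection hypothesis lets the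
last steps before `n` be indexed as `A 1, A 2, …` independently of `n`, so the impulse responses
depend only on the age of the impulse. For the closed loop it holds at multiples of `ℓ`, because the
step depends only on whether `ℓ` divides the time. -/
theorem eq_backwardFlow_add_sum {A : ℕ → E →ₗ[ℝ] E} {e u : ℕ → E} {n : ℕ}
    (hA : ∀ j < n, A (n - 1 - j) = A (j + 1)) (he : ∀ k, e (k + 1) = A k (e k) + u k) {i : ℕ}
    (hi : i ≤ n) :
    e n = backwardFlow A i (e (n - i))
      + ∑ j ∈ Finset.range i, backwardFlow A j (u (n - 1 - j)) := by
  induction i with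
  | zero => simp [backwardFlow]
  | succ i ih =>
    rw [ih (by omega), Finset.sum_range_succ, show n - i = (n - (i + 1)) + 1 by omega, he,
      show n - (i + 1) = n - 1 - i by omega, hA i (by omega), backwardFlow]
    simp only [map_add, LinearMap.comp_apply]
    abel

theorem summable_of_contracting_shift {a : ℕ → ℝ} (ha : ∀ i, 0 ≤ a i) {m : ℕ}
    (h : ∀ i, a (i + m) ≤ a i / 2) : Summable a := by
  refine summable_of_sum_range_le (c := 2 * ∑ i ∈ Finset.range m, a i) ha fun n => ?_
  have h1 : ∑ i ∈ Finset.range n, a i ≤ ∑ i ∈ Finset.range (m + n), a i :=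
    Finset.sum_le_sum_of_subset_of_nonneg (by simp) fun i _ _ => ha i
  rw [Finset.sum_range_add] at h1
  have h2 : ∑ i ∈ Finset.range n, a (m + i) ≤ ∑ i ∈ Finset.range n, a i / 2 :=
    Finset.sum_le_sum fun i _ => by rw [add_comm]; exact h i
  rw [← Finset.sum_div] at h2
  linarith

variable [FiniteDimensional ℝ E]

/-- Transition maps of a periodic system with asymptotically stable monodromy are summable. -/
theorem exists_summable_bound_backwardFlow {A : ℕ → E →ₗ[ℝ] E} {l : ℕ}
    (hA : ∀ i, A (i + l) = A i)
    (h : ∀ x, Tendsto (fun K => (backwardFlow A l ^ K) x) atTop (𝓝 0)) :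
    ∃ b : ℕ → ℝ, Summable b ∧ (∀ i, 0 ≤ b i) ∧ ∀ i x, ‖backwardFlow A i x‖ ≤ b i * ‖x‖ := by
  let T : ℕ → E →L[ℝ] E := fun i => (backwardFlow A i).toContinuousLinearMap
  have hT : ∀ i x, T i x = backwardFlow A i x := fun _ _ => rfl
  -- Pointwise decay on a basis gives decay in operator norm; a norm of at most one half over `m`
  -- periods then gives geometric decay of all transition maps.
  have hb : ∃ m, ‖T (m * l)‖ ≤ 1 / 2 := by
    let v := Module.finBasis ℝ E
    obtain ⟨C, hC, hCb⟩ := v.exists_opNorm_le (F := E)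
    have hlim : ∀ j, ∀ᶠ K in atTop, ‖T (K * l) (v j)‖ < 1 / (2 * C) := fun j => by
      have := (h (v j)).norm
      rw [norm_zero] at this
      have := this.eventually (gt_mem_nhds (show (0 : ℝ) < 1 / (2 * C) by positivity))
      filter_upwards [this] with K hK
      rwa [hT, backwardFlow_mul hA]
    obtain ⟨m, hm⟩ := (eventually_all.2 hlim).exists
    refine ⟨m, (hCb (u := T (m * l)) (M := 1 / (2 * C)) (by positivity) fun j => (hm j).le).trans ?_⟩
    rw [mul_one_div, div_le_iff₀ (by positivity)]
    linarith
  obtain ⟨m, hm⟩ := hb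
  refine ⟨fun i => ‖T i‖, summable_of_contracting_shift (m := m * l) (fun _ => norm_nonneg _) ?_,
    fun _ => norm_nonneg _, fun i x => (T i).le_opNorm x⟩
  intro i
  have : T (i + m * l) = T (m * l) ∘L T i := by
    ext x
    simp only [hT, ContinuousLinearMap.comp_apply]
    rw [add_comm, backwardFlow_mul_add hA, backwardFlow_mul hA]
    rfl
  rw [this]
  refine (ContinuousLinearMap.opNorm_comp_le _ _).trans ?_
  nlinarith [norm_nonneg (T i)]

theorem exists_summable_bound_pow {A : E →ₗ[ℝ] E}
    (h : ∀ x, Tendsto (fun K => (A ^ K) x) atTop (𝓝 0)) :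
    ∃ b : ℕ → ℝ, Summable b ∧ (∀ i, 0 ≤ b i) ∧ ∀ i x, ‖(A ^ i) x‖ ≤ b i * ‖x‖ := by
  have := exists_summable_bound_backwardFlow (A := fun _ => A) (l := 1) (fun _ => rfl)
  simpa only [backwardFlow_const, pow_one, h, implies_true, true_implies] using this

/-- A stable system with summable input has summable state. -/
theorem summable_norm_of_stable {A : E →ₗ[ℝ] E}
    (h : ∀ x, Tendsto (fun K => (A ^ K) x) atTop (𝓝 0)) {x u : ℕ → E}
    (hx : ∀ k, x (k + 1) = A (x k) + u k) (hu : Summable fun k => ‖u k‖) :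
    Summable fun k => ‖x k‖ := by
  obtain ⟨b, hb, hb0, hbA⟩ := exists_summable_bound_pow h
  rw [← summable_nat_add_iff 1]
  -- The state is bounded by a Cauchy product of two summable sequences.
  have h1 := summable_norm_sum_mul_range_of_summable_norm (f := b) (g := fun k => ‖u k‖)
    (by simpa [abs_of_nonneg (hb0 _)] using hb) (by simpa using hu)
  refine Summable.of_nonneg_of_le (fun _ => norm_nonneg _) (fun n => ?_)
    (((summable_nat_add_iff 1).2 (hb.mul_right ‖x 0‖)).add h1)
  have h2 := eq_backwardFlow_add_sum (A := fun _ => A) (n := n + 1) (fun _ _ => rfl) hx le_rfl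
  simp only [backwardFlow_const, Nat.sub_self, Nat.add_sub_cancel] at h2
  rw [h2]
  refine (norm_add_le _ _).trans (add_le_add (hbA _ _) ((norm_sum_le _ _).trans ?_))
  exact (Finset.sum_le_sum fun j _ => hbA _ _).trans (le_abs_self _)

theorem summable_norm_map {F : Type*} [NormedAddCommGroup F] [NormedSpace ℝ F] (f : E →ₗ[ℝ] F)
    {u : ℕ → E} (hu : Summable fun k => ‖u k‖) : Summable fun k => ‖f (u k)‖ :=
  Summable.of_nonneg_of_le (fun _ => norm_nonneg _)
    (fun k => f.toContinuousLinearMap.le_opNorm (u k)) (hu.mul_left _)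

end LinearSystems

/-! ### Second-order stability criterion -/

section SecondOrder

/-- The numbers `a`, `b` are the roots of `z² - t z + d`. If they are real, positivity of the
polynomial at `1` and `-1` confines them to the open interval; otherwise they are conjugate with
squared modulus `d`. -/
theorem norm_lt_one_of_jury_complex {t d : ℝ} (hd : d < 1) (h1 : 0 < 1 - t + d)
    (h2 : 0 < 1 + t + d) :
    ∃ a b : ℂ, a + b = t ∧ a * b = d ∧ ‖a‖ < 1 ∧ ‖b‖ < 1 := by
  by_cases hD : 0 ≤ t ^ 2 - 4 * d
  · set s := √(t ^ 2 - 4 * d)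
    have hs : s ^ 2 = t ^ 2 - 4 * d := Real.sq_sqrt hD
    have hs0 : 0 ≤ s := Real.sqrt_nonneg _
    have ht1 : t < 2 := by nlinarith
    have ht2 : -2 < t := by nlinarith
    have hs1 : s < 2 - t := lt_of_pow_lt_pow_left₀ 2 (by linarith) (by nlinarith)
    have hs2 : s < 2 + t := lt_of_pow_lt_pow_left₀ 2 (by linarith) (by nlinarith)
    refine ⟨((t + s) / 2 : ℝ), ((t - s) / 2 : ℝ), ?_, ?_, ?_, ?_⟩
    · push_cast; ring
    · norm_cast; linarith
    · rw [Complex.norm_real, Real.norm_eq_abs, abs_lt]; constructor <;> linarith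
    · rw [Complex.norm_real, Real.norm_eq_abs, abs_lt]; constructor <;> linarith
  · push Not at hD
    set s := √(4 * d - t ^ 2)
    have hs : s ^ 2 = 4 * d - t ^ 2 := Real.sq_sqrt (by linarith)
    have key : ∀ z : ℂ, Complex.normSq z = d → ‖z‖ < 1 := fun z hz => by
      rw [Complex.normSq_eq_norm_sq] at hz
      nlinarith [norm_nonneg z]
    refine ⟨⟨t / 2, s / 2⟩, ⟨t / 2, -(s / 2)⟩, ?_, ?_, key _ ?_, key _ ?_⟩
    · apply Complex.ext <;> simp
    · apply Complex.ext <;> simp <;> linarith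
    · rw [Complex.normSq_mk]; linarith
    · rw [Complex.normSq_mk]; linarith

/-- Jury's criterion for a second-order linear recurrence. -/
theorem tendsto_zero_of_jury {t d : ℝ} (hd : d < 1) (h1 : 0 < 1 - t + d) (h2 : 0 < 1 + t + d)
    {s : ℕ → ℝ} (hs : ∀ k, s (k + 2) = t * s (k + 1) - d * s k) : Tendsto s atTop (𝓝 0) := by
  obtain ⟨a, b, hab, hab', ha, hb⟩ := norm_lt_one_of_jury_complex hd h1 h2
  -- Factoring the recurrence leaves a first-order system with multiplier `b` and geometric input of
  -- ratio `a`, so a double root needs no separate treatment.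
  have hw : ∀ k, (s (k + 1) : ℂ) - b * s k = a ^ k * (s 1 - b * s 0) := fun k => by
    induction k with
    | zero => simp
    | succ k ih =>
      rw [pow_succ', mul_assoc, ← ih, hs]
      push_cast
      rw [← hab, ← hab']
      ring
  have hst : ∀ x, Tendsto (fun K => ((LinearMap.mulLeft ℝ b) ^ K) x) atTop (𝓝 0) := fun x => by
    have : ∀ K, ((LinearMap.mulLeft ℝ b) ^ K) x = b ^ K * x := fun K => by
      induction K with
      | zero => simp
      | succ K ih => rw [pow_succ', Module.End.mul_apply, ih, pow_succ']; simp [mul_assoc]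
    simp only [this]
    simpa using (tendsto_pow_atTop_nhds_zero_of_norm_lt_one hb).mul_const x
  have hsum := summable_norm_of_stable hst (x := fun k => (s k : ℂ))
    (u := fun k => a ^ k * (s 1 - b * s 0))
    (fun k => by rw [← hw]; simp) (by
      simp only [norm_mul, norm_pow]
      exact (summable_geometric_of_lt_one (norm_nonneg _) ha).mul_right _)
  have := hsum.tendsto_atTop_zero
  simp only [Complex.norm_real] at this
  exact tendsto_zero_iff_norm_tendsto_zero.2 this

theorem toLin'_pow_apply {n : Type*} [Fintype n] [DecidableEq n] (M : Matrix n n ℝ) (k : ℕ)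
    (x : n → ℝ) : (toLin' M ^ k) x = M ^ k *ᵥ x := by
  rw [← toLin'_pow, toLin'_apply]

/-- A clock under static feedback of its own state. -/
def feedbackMatrix (γ α T : ℝ) : Matrix (Fin 2) (Fin 2) ℝ :=
  clockA T - vecMulVec (clockB T) (gainRow γ α T)

theorem feedbackMatrix_eq (γ α : ℝ) {T : ℝ} (hT : T ≠ 0) :
    feedbackMatrix γ α T = !![1 - γ * α, T - T * γ; -(γ * α / T), 1 - γ] := by
  ext i j
  fin_cases i <;> fin_cases j <;>
    simp [feedbackMatrix, clockA, clockB, gainRow] <;> field_simp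

/-- By Cayley–Hamilton each component satisfies the recurrence with trace `2 - γ - γα` and
determinant `1 - γ`. Jury's three inequalities read `γ > 0`, `γα > 0` and `4 - 2γ - γα > 0`. -/
theorem feedbackMatrix_stable {γ α T : ℝ} (hT : 0 < T) (hγ : 0 < γ) (hγ' : γ < 4 / (2 + α))
    (hα : 0 < α) (z : Fin 2 → ℝ) :
    Tendsto (fun k => (toLin' (feedbackMatrix γ α T) ^ k) z) atTop (𝓝 0) := by
  rw [lt_div_iff₀ (by linarith)] at hγ'
  have hγα : 0 < γ * α := mul_pos hγ hα
  have hM : feedbackMatrix γ α T * feedbackMatrix γ α T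
      = (2 - γ - γ * α) • feedbackMatrix γ α T - (1 - γ) • (1 : Matrix (Fin 2) (Fin 2) ℝ) := by
    rw [feedbackMatrix_eq γ α hT.ne']
    ext i j
    fin_cases i <;> fin_cases j <;> simp [Matrix.mul_apply, Fin.sum_univ_two] <;> field_simp <;>
      ring
  rw [tendsto_pi_nhds]
  intro i
  refine tendsto_zero_of_jury (t := 2 - γ - γ * α) (d := 1 - γ) (by linarith) (by nlinarith)
    (by nlinarith) fun k => ?_
  simp only [toLin'_pow_apply]
  rw [pow_add, pow_two, hM, mul_sub, mul_smul_comm, mul_smul_comm, mul_one, ← pow_succ,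
    sub_mulVec, smul_mulVec, smul_mulVec]
  rfl

/-- Stability forces the determinant and every real eigenvalue into `(-1, 1)`. If the characteristic
polynomial `p` violates one of Jury's conditions at `±1`, it has a real root outside that interval.
-/
theorem gain_bounds_of_feedbackMatrix_stable {γ α T : ℝ} (hT : 0 < T)
    (h : ∀ z, Tendsto (fun k => (toLin' (feedbackMatrix γ α T) ^ k) z) atTop (𝓝 0)) :
    (0 < γ ∧ γ < 4 / (2 + α)) ∧ 0 < α := by
  set M := feedbackMatrix γ α T with hMdef
  simp only [toLin'_pow_apply] at h
  have hroot : ∀ lam : ℝ, lam ^ 2 - (2 - γ - γ * α) * lam + (1 - γ) = 0 → |lam| < 1 := by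
    intro lam hlam
    have hdet : (M - lam • (1 : Matrix (Fin 2) (Fin 2) ℝ)).det = 0 := by
      rw [hMdef, feedbackMatrix_eq γ α hT.ne', det_fin_two]
      simp
      field_simp
      linarith
    obtain ⟨z, hz, hMz⟩ := exists_mulVec_eq_zero_iff.2 hdet
    have hMz' : M *ᵥ z = lam • z := by
      rw [sub_mulVec, smul_mulVec, one_mulVec] at hMz
      exact sub_eq_zero.1 hMz
    have hpow : ∀ k, M ^ k *ᵥ z = lam ^ k • z := fun k => by
      induction k with
      | zero => simp
      | succ k ih => rw [pow_succ, ← mulVec_mulVec, hMz', mulVec_smul, ih, smul_smul, pow_succ']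
    obtain ⟨i, hi⟩ := Function.ne_iff.1 hz
    have hlim := (tendsto_pi_nhds.1 (h z) i).div_const (z i)
    simp only [hpow, Pi.smul_apply, smul_eq_mul, Pi.zero_apply, zero_div] at hlim
    simp only [mul_div_assoc, div_self hi, mul_one] at hlim
    exact tendsto_pow_atTop_nhds_zero_iff.1 hlim
  have hdet : |1 - γ| < 1 := by
    have hd : M.det = 1 - γ := by
      rw [hMdef, feedbackMatrix_eq γ α hT.ne', det_fin_two]
      simp
      field_simp
      ring
    rw [← tendsto_pow_atTop_nhds_zero_iff, ← hd]
    have hentry : ∀ i j, Tendsto (fun k => (M ^ k) i j) atTop (𝓝 0) := fun i j => by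
      have := tendsto_pi_nhds.1 (h (Pi.single j 1)) i
      simpa using this
    have hpow : ∀ k, M.det ^ k = (M ^ k) 0 0 * (M ^ k) 1 1 - (M ^ k) 0 1 * (M ^ k) 1 0 :=
      fun k => by rw [← det_pow, det_fin_two]
    simp only [hpow]
    simpa using ((hentry 0 0).mul (hentry 1 1)).sub ((hentry 0 1).mul (hentry 1 0))
  rw [abs_lt] at hdet
  have hγ : 0 < γ := by linarith
  have h1 : 0 < γ * α := by
    by_contra hneg
    push Not at hneg
    -- The two sides differ by `-4γα = -4 p(1)`; hence the larger root is at least `1`.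
    have hD : (γ + γ * α) ^ 2 ≤ (2 - γ - γ * α) ^ 2 - 4 * (1 - γ) := by nlinarith
    have hs := Real.sq_sqrt ((sq_nonneg _).trans hD)
    have hs2 := Real.abs_le_sqrt hD
    have := hroot ((2 - γ - γ * α + √((2 - γ - γ * α) ^ 2 - 4 * (1 - γ))) / 2) (by nlinarith)
    rw [abs_lt] at this
    linarith [le_abs_self (γ + γ * α)]
  have h2 : 0 < 4 - 2 * γ - γ * α := by
    by_contra hneg
    push Not at hneg
    -- The two sides differ by `-4 p(-1)`; hence the smaller root is at most `-1`.
    have hD : (4 - γ - γ * α) ^ 2 ≤ (2 - γ - γ * α) ^ 2 - 4 * (1 - γ) := by nlinarith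
    have hs := Real.sq_sqrt ((sq_nonneg _).trans hD)
    have hs2 := Real.abs_le_sqrt hD
    have := hroot ((2 - γ - γ * α - √((2 - γ - γ * α) ^ 2 - 4 * (1 - γ))) / 2) (by nlinarith)
    rw [abs_lt] at this
    linarith [le_abs_self (4 - γ - γ * α)]
  have hα : 0 < α := (pos_iff_pos_of_mul_pos h1).1 hγ
  exact ⟨⟨hγ, by rw [lt_div_iff₀ (by linarith)]; linarith⟩, hα⟩

end SecondOrder

/-! ### Steady-state Kalman gains -/

section Kalman

variable {n m : Type*} [Fintype n] [Fintype m]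

/-- The form attains a positive minimum on the compact unit sphere, and homogeneity does the rest;
an empty index type makes the sphere empty and is treated apart. -/
theorem exists_pos_mul_sq_norm_le {Q : Matrix n n ℝ} (hQ : ∀ y, y ≠ 0 → 0 < y ⬝ᵥ Q *ᵥ y) :
    ∃ c > 0, ∀ y, c * ‖y‖ ^ 2 ≤ y ⬝ᵥ Q *ᵥ y := by
  have hcont : Continuous fun y : n → ℝ => y ⬝ᵥ Q *ᵥ y := by fun_prop
  rcases (Metric.sphere (0 : n → ℝ) 1).eq_empty_or_nonempty with he | hne
  · refine ⟨1, one_pos, fun y => ?_⟩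
    have hy : y = 0 := by
      by_contra hy
      have : (‖y‖⁻¹ • y) ∈ Metric.sphere (0 : n → ℝ) 1 := by
        simp [norm_smul, norm_ne_zero_iff.2 hy]
      rw [he] at this
      exact this
    simp [hy]
  · obtain ⟨y₀, hy₀, hmin⟩ := (isCompact_sphere (0 : n → ℝ) 1).exists_isMinOn hne hcont.continuousOn
    have hy₀' : y₀ ≠ 0 := by
      rintro rfl
      simp at hy₀
    refine ⟨_, hQ y₀ hy₀', fun y => ?_⟩
    rcases eq_or_ne y 0 with rfl | hy
    · simp
    have hy' : ‖y‖ ≠ 0 := norm_ne_zero_iff.2 hy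
    have h := hmin (show (‖y‖⁻¹ • y) ∈ Metric.sphere (0 : n → ℝ) 1 by simp [norm_smul, hy'])
    simp only [Set.mem_ofPred_eq, mulVec_smul, dotProduct_smul, smul_dotProduct, smul_eq_mul] at h
    calc _ ≤ ‖y‖⁻¹ * (‖y‖⁻¹ * y ⬝ᵥ Q *ᵥ y) * ‖y‖ ^ 2 := by gcongr
      _ = _ := by field_simp

theorem tendsto_zero_of_quadraticForm {Q : Matrix n n ℝ} (hQ : ∀ y, y ≠ 0 → 0 < y ⬝ᵥ Q *ᵥ y)
    {y : ℕ → n → ℝ} (h : Tendsto (fun k => y k ⬝ᵥ Q *ᵥ y k) atTop (𝓝 0)) :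
    Tendsto y atTop (𝓝 0) := by
  obtain ⟨c, hc, hcy⟩ := exists_pos_mul_sq_norm_le hQ
  rw [tendsto_zero_iff_norm_tendsto_zero]
  have h2 : Tendsto (fun k => ‖y k‖ ^ 2) atTop (𝓝 0) := by
    refine squeeze_zero (fun _ => by positivity) (fun k => ?_) (by simpa using h.div_const c)
    rw [le_div_iff₀ hc]
    linarith [hcy (y k)]
  simpa using h2.sqrt

variable [DecidableEq m]

/-- The closed-loop (Joseph) form of the Riccati equation. -/
theorem IsSteadyKalmanGain.joseph {A Q : Matrix n n ℝ} {C : Matrix m n ℝ} {R : Matrix m m ℝ}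
    {H : Matrix n m ℝ} (hR : R.PosDef) (h : IsSteadyKalmanGain A C Q R H) :
    ∃ P : Matrix n n ℝ, P.PosSemidef ∧ P = A * P * Aᵀ - H * C * P * Aᵀ + Q ∧
      P = (A - H * C) * P * (A - H * C)ᵀ + H * R * Hᵀ + Q := by
  obtain ⟨P, hP, hRic, hH⟩ := h
  have hRic' : P = A * P * Aᵀ - H * C * P * Aᵀ + Q := by rw [hH]; exact hRic
  refine ⟨P, hP, hRic', ?_⟩
  have hS : (C * P * Cᵀ + R).PosDef := by
    have := hP.mul_mul_conjTranspose_same C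
    rw [conjTranspose_eq_transpose_of_trivial] at this
    exact Matrix.PosDef.posSemidef_add this hR
  have hHS : H * (C * P * Cᵀ + R) = A * P * Cᵀ := by
    rw [hH, Matrix.mul_assoc, nonsing_inv_mul _ hS.det_pos.ne'.isUnit, Matrix.mul_one]
  have hHR : H * R = A * P * Cᵀ - H * (C * P * Cᵀ) := by
    rw [← hHS, Matrix.mul_add]; abel
  rw [hHR]
  nth_rewrite 1 [hRic']
  simp only [transpose_sub, transpose_mul, Matrix.sub_mul, Matrix.mul_sub, Matrix.mul_assoc]
  abel

/-- The estimation error dynamics under a steady-state Kalman gain are asymptotically stable as soon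
as the process noise is nondegenerate. -/
theorem IsSteadyKalmanGain.stable [DecidableEq n] {A Q : Matrix n n ℝ} {C : Matrix m n ℝ}
    {R : Matrix m m ℝ}
    {H : Matrix n m ℝ} (hR : R.PosDef) (hQ : ∀ y, y ≠ 0 → 0 < y ⬝ᵥ Q *ᵥ y)
    (h : IsSteadyKalmanGain A C Q R H) (x : n → ℝ) :
    Tendsto (fun k => (toLin' (A - H * C) ^ k) x) atTop (𝓝 0) := by
  obtain ⟨P, hP, -, hJ⟩ := h.joseph hR
  set M := A - H * C
  have hleft : ∀ y : n → ℝ, Tendsto (fun k => y ᵥ* M ^ k) atTop (𝓝 0) := fun y => by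
    refine tendsto_zero_of_quadraticForm hQ ?_
    set a : ℕ → n → ℝ := fun k => y ᵥ* M ^ k
    have hQ0 : ∀ z, 0 ≤ z ⬝ᵥ Q *ᵥ z := fun z => by
      rcases eq_or_ne z 0 with rfl | hz
      · simp
      · exact (hQ z hz).le
    -- By the Joseph form, `P` is a Lyapunov function for the transposed error dynamics. The
    -- decrements telescope, so the `Q`-forms are summable.
    have hstep : ∀ k, a (k + 1) ⬝ᵥ P *ᵥ a (k + 1) + a k ⬝ᵥ Q *ᵥ a k ≤ a k ⬝ᵥ P *ᵥ a k := by
      intro k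
      have ha : a (k + 1) = a k ᵥ* M := by simp only [a, pow_succ, vecMul_vecMul]
      have hRk := hR.posSemidef.dotProduct_mulVec_nonneg (a k ᵥ* H)
      rw [star_trivial] at hRk
      have : a k ⬝ᵥ P *ᵥ a k = a (k + 1) ⬝ᵥ P *ᵥ a (k + 1)
          + (a k ᵥ* H) ⬝ᵥ R *ᵥ (a k ᵥ* H) + a k ⬝ᵥ Q *ᵥ a k := by
        nth_rewrite 1 [hJ]
        rw [ha, add_mulVec, add_mulVec, dotProduct_add, dotProduct_add]
        simp only [← mulVec_mulVec, mulVec_transpose, dotProduct_mulVec, vecMul_vecMul]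
      linarith
    have hP0 : ∀ k, 0 ≤ a k ⬝ᵥ P *ᵥ a k := fun k => by
      simpa using hP.dotProduct_mulVec_nonneg (a k)
    refine (summable_of_sum_range_le (c := a 0 ⬝ᵥ P *ᵥ a 0) (fun k => hQ0 _)
      fun k => ?_).tendsto_atTop_zero
    have : ∑ i ∈ Finset.range k, a i ⬝ᵥ Q *ᵥ a i ≤ a 0 ⬝ᵥ P *ᵥ a 0 - a k ⬝ᵥ P *ᵥ a k := by
      induction k with
      | zero => simp
      | succ k ih => rw [Finset.sum_range_succ]; linarith [hstep k]
    linarith [hP0 k]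
  rw [tendsto_pi_nhds]
  intro i
  have h1 := tendsto_pi_nhds.1 (hleft (Pi.single i 1))
  have h2 : Tendsto (fun k => ∑ j, (Pi.single i 1 ᵥ* M ^ k) j * x j) atTop
      (𝓝 (∑ j : n, (0 : n → ℝ) j * x j)) :=
    tendsto_finsetSum _ fun j _ => (h1 j).mul_const (x j)
  simpa [toLin'_pow_apply, mulVec, dotProduct] using h2

end Kalman

/-! ### Stacked matrices and edge noise -/

theorem stackA_mulVec_apply {m : Type*} [Fintype m] [DecidableEq m] (τ : ℝ) (s : Fin 2 × m → ℝ)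
    (a : Fin 2) (i : m) : (stackA τ m *ᵥ s) (a, i) = (clockA τ *ᵥ fun b => s (b, i)) a := by
  simp [stackA, mulVec, dotProduct, Fintype.sum_prod_type, kroneckerMap_apply, one_apply]

theorem stackB_mulVec_apply {m : Type*} [Fintype m] [DecidableEq m] (τ : ℝ) (η : m → ℝ)
    (a : Fin 2) (i : m) : (stackB τ m *ᵥ η) (a, i) = clockB τ a * η i := by
  simp [stackB, mulVec, dotProduct, one_apply]

theorem stackC_mulVec_apply {m : Type*} [Fintype m] [DecidableEq m] (s : Fin 2 × m → ℝ) (i : m) :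
    (stackC m *ᵥ s) i = s (0, i) := by
  simp [stackC, clockC, mulVec, dotProduct, Fintype.sum_prod_type, one_apply]

theorem clockA_mulVec (τ : ℝ) (z : Fin 2 → ℝ) : clockA τ *ᵥ z = ![z 0 + τ * z 1, z 1] := by
  ext i
  fin_cases i <;> simp [clockA, mulVec, dotProduct, Fin.sum_univ_two]

theorem weighted_stackA {m : Type*} [Fintype m] [DecidableEq m] (τ : ℝ) (q : m → ℝ)
    (s : Fin 2 × m → ℝ) : weighted q (stackA τ m *ᵥ s) = clockA τ *ᵥ weighted q s := by
  ext a
  fin_cases a <;> simp [weighted, stackA_mulVec_apply, mul_add,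
    Finset.sum_add_distrib, Finset.mul_sum, mul_left_comm]

theorem weighted_stackB {m : Type*} [Fintype m] [DecidableEq m] (τ : ℝ) (q : m → ℝ)
    (η : m → ℝ) : weighted q (stackB τ m *ᵥ η) = (q ⬝ᵥ η) • clockB τ := by
  ext a
  simp [weighted, stackB_mulVec_apply, dotProduct, Finset.sum_mul, mul_assoc, mul_comm (clockB τ a)]

theorem weighted_add {m : Type*} [Fintype m] (q : m → ℝ) (s t : Fin 2 × m → ℝ) :
    weighted q (s + t) = weighted q s + weighted q t := by
  ext a
  simp [weighted, mul_add, Finset.sum_add_distrib]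

theorem weighted_sub {m : Type*} [Fintype m] (q : m → ℝ) (s t : Fin 2 × m → ℝ) :
    weighted q (s - t) = weighted q s - weighted q t := by
  ext a
  simp [weighted, mul_sub]

theorem weighted_smul {m : Type*} [Fintype m] (q : m → ℝ) (r : ℝ) (s : Fin 2 × m → ℝ) :
    weighted q (r • s) = r • weighted q s := by
  ext a
  simp [weighted, Finset.mul_sum, mul_left_comm]

namespace ClockEnsemble

variable {N : ℕ} (E : ClockEnsemble N)

theorem Γ_pos {T : ℝ} (hT : 0 < T) (i : Fin N) : 0 < E.Γ T i := by
  have := E.σ₁_pos i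
  have := E.σ₂_pos i
  unfold Γ
  positivity

/-- Completing the square in the frequency, with `τ²/3 = τ²/4 + τ²/12`, makes positivity visible. -/
theorem Q_quadraticForm (z : Fin 2 × Fin N → ℝ) :
    z ⬝ᵥ E.Q *ᵥ z = ∑ i, (E.τ * E.σ₁ i ^ 2 * z (0, i) ^ 2
      + E.τ * E.σ₂ i ^ 2 * ((E.τ / 2 * z (0, i) + z (1, i)) ^ 2 + E.τ ^ 2 / 12 * z (0, i) ^ 2)) := by
  simp only [dotProduct, mulVec, Fintype.sum_prod_type, Fin.sum_univ_two, Q, of_apply, ite_mul,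
    zero_mul, Finset.sum_ite_eq, Finset.mem_univ, if_true, clockQ]
  rw [← Finset.sum_add_distrib]
  refine Finset.sum_congr rfl fun i _ => ?_
  simp
  ring

theorem Q_pos (z : Fin 2 × Fin N → ℝ) (hz : z ≠ 0) : 0 < z ⬝ᵥ E.Q *ᵥ z := by
  have hτ := E.τ_pos
  rw [Q_quadraticForm]
  refine Finset.sum_pos' (fun i _ => by positivity) ?_
  by_contra! hcon
  refine hz (funext fun p => ?_)
  have h1 := E.σ₁_pos p.2
  have h2 := E.σ₂_pos p.2
  have h := hcon p.2 (Finset.mem_univ _)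
  have e1 : 0 ≤ E.τ * E.σ₂ p.2 ^ 2 * ((E.τ / 2 * z (0, p.2) + z (1, p.2)) ^ 2
    + E.τ ^ 2 / 12 * z (0, p.2) ^ 2) := by positivity
  have e2 : 0 ≤ E.τ * E.σ₁ p.2 ^ 2 * z (0, p.2) ^ 2 := by positivity
  have h0 : z (0, p.2) = 0 := by
    have : E.τ * E.σ₁ p.2 ^ 2 * z (0, p.2) ^ 2 = 0 := by linarith
    simpa [hτ.ne', h1.ne'] using this
  rw [h0] at h e1
  have h1' : z (1, p.2) = 0 := by
    have : E.τ * E.σ₂ p.2 ^ 2 * z (1, p.2) ^ 2 = 0 := by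
      have e3 : 0 ≤ E.τ * E.σ₂ p.2 ^ 2 * z (1, p.2) ^ 2 := by positivity
      norm_num at h
      linarith
    simpa [hτ.ne', h2.ne'] using this
  obtain ⟨a, i⟩ := p
  fin_cases a
  · exact h0
  · exact h1'

section Edges

variable {E} {m : Type}

theorem incidence_mulVec (d : m → E.graph.Dart) (f : Fin N → ℝ) (e : m) :
    (incidence d *ᵥ f) e = f (d e).snd - f (d e).fst := by
  simp [incidence, mulVec, dotProduct, sub_mul]

variable [Fintype m] [DecidableEq m]

theorem edgeQ_pos {d : m → E.graph.Dart} (hd : ∀ y, y ᵥ* incidence d = 0 → y = 0)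
    (y : Fin 2 × m → ℝ) (hy : y ≠ 0) : 0 < y ⬝ᵥ edgeQ d *ᵥ y := by
  set B := (1 : Matrix (Fin 2) (Fin 2) ℝ) ⊗ₖ incidence d
  have h : y ⬝ᵥ edgeQ d *ᵥ y = (y ᵥ* B) ⬝ᵥ E.Q *ᵥ (y ᵥ* B) := by
    rw [edgeQ, ← mulVec_mulVec, ← mulVec_mulVec, dotProduct_mulVec, mulVec_transpose]
  rw [h]
  refine E.Q_pos _ fun h0 => hy (funext fun p => ?_)
  refine congrFun (hd (fun e => y (p.1, e)) (funext fun i => ?_)) p.2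
  have := congrFun h0 (p.1, i)
  simpa [B, vecMul, dotProduct, Fintype.sum_prod_type, kroneckerMap_apply, one_apply] using this

theorem IsEdgeKalmanGain.stable {d : m → E.graph.Dart} (hd : ∀ y, y ᵥ* incidence d = 0 → y = 0)
    {H : Matrix (Fin 2 × m) m ℝ} (hH : IsEdgeKalmanGain d H) (x : Fin 2 × m → ℝ) :
    Tendsto (fun k => (toLin' (stackA E.τ m - H * stackC m) ^ k) x) atTop (𝓝 0) :=
  IsSteadyKalmanGain.stable (PosDef.one.smul E.R_pos) (edgeQ_pos hd) hH x

/-- The frequency rows of a steady-state Kalman gain are linearly independent. -/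
theorem IsEdgeKalmanGain.exists_ne_zero {d : m → E.graph.Dart}
    (hd : ∀ y, y ᵥ* incidence d = 0 → y = 0) {H : Matrix (Fin 2 × m) m ℝ}
    (hH : IsEdgeKalmanGain d H) {g : m → ℝ} (hg : g ≠ 0) :
    ∃ w, weighted g (H *ᵥ w) 1 ≠ 0 := by
  by_contra! hcon
  obtain ⟨P, -, hP, -⟩ := IsSteadyKalmanGain.joseph (PosDef.one.smul E.R_pos) hH
  set p : Fin 2 × m → ℝ := fun s => if s.1 = 1 then g s.2 else 0 with hp
  have hpH : p ᵥ* H = 0 := by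
    ext w
    have := hcon (Pi.single w 1)
    simpa [weighted, p, vecMul, dotProduct, Fintype.sum_prod_type] using this
  -- A covector supported on the frequencies is fixed by `A ⊗ I`. If the gain also annihilated it,
  -- the Riccati equation would give `pPp = pPp + pQp` with `pQp > 0`.
  have hpA : p ᵥ* stackA E.τ m = p := by
    ext s
    obtain ⟨a, i⟩ := s
    fin_cases a <;> simp [stackA, clockA, p, vecMul, dotProduct, Fintype.sum_prod_type,
      kroneckerMap_apply, one_apply]
  have hne : p ≠ 0 := fun h0 => hg (funext fun i => by simpa [p] using congrFun h0 (1, i))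
  have hQ := edgeQ_pos hd p hne
  have h1 : p ⬝ᵥ P *ᵥ p = p ⬝ᵥ P *ᵥ p - 0 + p ⬝ᵥ edgeQ d *ᵥ p := by
    nth_rewrite 1 [hP]
    rw [add_mulVec, sub_mulVec, dotProduct_add, dotProduct_sub]
    simp only [← mulVec_mulVec, mulVec_transpose, dotProduct_mulVec, hpA, hpH, zero_vecMul,
      zero_dotProduct]
  linarith

/-- The sub-edges at a clock form a star: the column of each neighbour has a single nonzero entry.
-/
theorem nbrDart_vecMul_incidence (i : Fin N) (y : E.Nbr i → ℝ)
    (hy : y ᵥ* incidence (E.nbrDart i) = 0) : y = 0 := by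
  ext j
  have h := congrFun hy j.1
  have hne : j.1 ≠ i := j.2.ne'
  simpa [vecMul, dotProduct, incidence, nbrDart, hne, mul_sub, Subtype.ext_iff,
    ← Subtype.ext_iff] using h

end Edges

/-! ### Synchronization -/

/-- The synchronization control in terms of the clock states `x` and the estimation errors `ε`. -/
def syncControl (γ α : ℝ) :
    ((Fin 2 × Fin N → ℝ) × (∀ i : Fin N, Fin 2 × E.Nbr i → ℝ)) →ₗ[ℝ] (Fin N → ℝ) where
  toFun s i := E.Γ E.τ i * (gainRow γ α E.τ ⬝ᵥ fun a => ∑ j : E.Nbr i,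
    (s.1 (a, j.1) - s.1 (a, i) - (s.2 i (a, j) - s.2 j.1 (a, ⟨i, j.2.symm⟩)) / 2))
  map_add' s t := by
    ext i
    simp only [dotProduct, Fin.sum_univ_two, Prod.fst_add, Prod.snd_add, Pi.add_apply]
    rw [← mul_add, add_add_add_comm, ← mul_add, ← mul_add, ← Finset.sum_add_distrib,
      ← Finset.sum_add_distrib]
    congr 3 <;> exact Finset.sum_congr rfl fun j _ => by ring
  map_smul' r s := by
    ext i
    simp only [dotProduct, Fin.sum_univ_two, Prod.smul_fst, Prod.smul_snd, Pi.smul_apply,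
      smul_eq_mul, RingHom.id_apply]
    simp only [← mul_sub, mul_div_assoc, ← Finset.mul_sum]
    ring

theorem syncControl_apply (γ α : ℝ) (x : Fin 2 × Fin N → ℝ)
    (ε : ∀ i : Fin N, Fin 2 × E.Nbr i → ℝ) (i : Fin N) :
    E.syncControl γ α (x, ε) i = E.Γ E.τ i * (gainRow γ α E.τ ⬝ᵥ fun a => ∑ j : E.Nbr i,
      (x (a, j.1) - x (a, i) - (ε i (a, j) - ε j.1 (a, ⟨i, j.2.symm⟩)) / 2)) := rfl

theorem sum_nbr_comm {M : Type*} [AddCommMonoid M] (f : ∀ i : Fin N, E.Nbr i → M) :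
    ∑ i, ∑ j, f i j = ∑ i, ∑ j : E.Nbr i, f j.1 ⟨i, j.2.symm⟩ := by
  rw [← Fintype.sum_sigma', ← Fintype.sum_sigma']
  let e : (Σ i, E.Nbr i) ≃ (Σ i, E.Nbr i) :=
    { toFun p := ⟨p.2.1, ⟨p.1, p.2.2.symm⟩⟩
      invFun p := ⟨p.2.1, ⟨p.1, p.2.2.symm⟩⟩
      left_inv _ := rfl
      right_inv _ := rfl }
  exact (e.sum_comp fun p => f p.1 p.2).symm

/-- The synchronization control does not move the mean weighted by `Γ(τ)⁻¹`. -/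
theorem dotProduct_syncControl {q : Fin N → ℝ} {κ : ℝ} (hq : ∀ i, q i * E.Γ E.τ i = κ) (γ α : ℝ)
    (x : Fin 2 × Fin N → ℝ) (ε : ∀ i : Fin N, Fin 2 × E.Nbr i → ℝ) :
    q ⬝ᵥ E.syncControl γ α (x, ε) = 0 := by
  -- The fused edge estimates are antisymmetric under reversal of the edge, so their total is zero;
  -- this is what the fusion is for.
  have h : ∀ a, ∑ i, ∑ j : E.Nbr i,
      (x (a, j.1) - x (a, i) - (ε i (a, j) - ε j.1 (a, ⟨i, j.2.symm⟩)) / 2) = 0 := fun a => by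
    have h1 := E.sum_nbr_comm fun i j =>
      (x (a, j.1) - x (a, i) - (ε i (a, j) - ε j.1 (a, ⟨i, j.2.symm⟩)) / 2)
    have h2 : ∑ i, ∑ j : E.Nbr i,
        (x (a, i) - x (a, j.1) - (ε j.1 (a, ⟨i, j.2.symm⟩) - ε i (a, j)) / 2)
        = - ∑ i, ∑ j : E.Nbr i,
        (x (a, j.1) - x (a, i) - (ε i (a, j) - ε j.1 (a, ⟨i, j.2.symm⟩)) / 2) := by
      simp only [← Finset.sum_neg_distrib]
      exact Finset.sum_congr rfl fun i _ => Finset.sum_congr rfl fun j _ => by ring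
    rw [h2] at h1
    linarith
  simp only [dotProduct, syncControl_apply, ← mul_assoc, hq, Fin.sum_univ_two]
  rw [← Finset.mul_sum, Finset.sum_add_distrib, ← Finset.mul_sum, ← Finset.mul_sum, h, h]
  simp

/-- Deviation of stacked states from their weighted mean. -/
def deviation (q : Fin N → ℝ) : (Fin 2 × Fin N → ℝ) →ₗ[ℝ] (Fin 2 × Fin N → ℝ) where
  toFun x p := x p - weighted q x p.1
  map_add' x y := by
    ext p
    simp only [weighted_add, Pi.add_apply]
    ring
  map_smul' r x := by
    ext p
    simp only [weighted_smul, Pi.smul_apply, smul_eq_mul, RingHom.id_apply]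
    ring

theorem deviation_apply (q : Fin N → ℝ) (x : Fin 2 × Fin N → ℝ) (p : Fin 2 × Fin N) :
    deviation q x p = x p - weighted q x p.1 := rfl

theorem weighted_deviation {q : Fin N → ℝ} (hq : ∑ i, q i = 1) (x : Fin 2 × Fin N → ℝ) :
    weighted q (deviation q x) = 0 := by
  ext a
  simp only [weighted, deviation_apply, mul_sub, Finset.sum_sub_distrib, ← Finset.sum_mul, hq,
    one_mul, sub_self, Pi.zero_apply]

/-- One step of the noise-free deviation from the `q`-weighted mean under synchronization. -/
def syncStep (q : Fin N → ℝ) (γ α : ℝ) :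
    ((Fin 2 × Fin N → ℝ) × (∀ i : Fin N, Fin 2 × E.Nbr i → ℝ)) →ₗ[ℝ] (Fin 2 × Fin N → ℝ) :=
  deviation q ∘ₗ (toLin' (stackA E.τ (Fin N)) ∘ₗ LinearMap.fst ℝ _ _
    + toLin' (stackB E.τ (Fin N)) ∘ₗ E.syncControl γ α)

theorem syncStep_apply (q : Fin N → ℝ) (γ α : ℝ) (x : Fin 2 × Fin N → ℝ)
    (ε : ∀ i : Fin N, Fin 2 × E.Nbr i → ℝ) :
    E.syncStep q γ α (x, ε) = deviation q (stackA E.τ (Fin N) *ᵥ x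
      + stackB E.τ (Fin N) *ᵥ E.syncControl γ α (x, ε)) := by
  simp [syncStep]

end ClockEnsemble

/-! ### Modal decomposition of the synchronization dynamics -/

namespace ClockEnsemble

variable {N : ℕ} (E : ClockEnsemble N)

theorem lapMatrix_mulVec_eq (f : Fin N → ℝ) (i : Fin N) :
    (E.graph.lapMatrix ℝ *ᵥ f) i = -∑ j : E.Nbr i, (f j.1 - f i) := by
  rw [SimpleGraph.lapMatrix_mulVec_apply, Finset.sum_sub_distrib,
    ← Finset.sum_subtype (E.graph.neighborFinset i) (fun j => by simp) f]
  have : Fintype.card (E.Nbr i) = E.graph.degree i := by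
    rw [← SimpleGraph.card_neighborFinset_eq_degree, Fintype.card_subtype]
    congr 1
    ext j
    simp
  simp [this]

theorem scaledLaplacian_posSemidef : E.scaledLaplacian.PosSemidef := by
  have := (SimpleGraph.posSemidef_lapMatrix ℝ E.graph).mul_mul_conjTranspose_same
    (diagonal fun i => √(E.Γ E.τ i))
  rwa [diagonal_conjTranspose, star_trivial] at this

theorem dotProduct_lapMatrix_comm (f g : Fin N → ℝ) :
    f ⬝ᵥ E.graph.lapMatrix ℝ *ᵥ g = (E.graph.lapMatrix ℝ *ᵥ f) ⬝ᵥ g := by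
  rw [dotProduct_mulVec, ← mulVec_transpose, (SimpleGraph.isSymm_lapMatrix ℝ E.graph).eq]

/-- Coordinates of stacked clock states along a vector of scaled modes. -/
def modeCoord (u : Fin N → ℝ) (x : Fin 2 × Fin N → ℝ) : Fin 2 → ℝ :=
  fun a => ∑ i, u i / √(E.Γ E.τ i) * x (a, i)

theorem modeCoord_eq_weighted (u : Fin N → ℝ) (x : Fin 2 × Fin N → ℝ) :
    E.modeCoord u x = weighted (fun i => u i / √(E.Γ E.τ i)) x := rfl

theorem scaledLaplacian_mulVec_apply (u : Fin N → ℝ) (i : Fin N) :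
    (E.scaledLaplacian *ᵥ u) i
      = √(E.Γ E.τ i) * (E.graph.lapMatrix ℝ *ᵥ fun j => √(E.Γ E.τ j) * u j) i := by
  have : (diagonal fun i => √(E.Γ E.τ i)) *ᵥ u = fun j => √(E.Γ E.τ j) * u j := by
    ext j
    rw [mulVec_diagonal]
  rw [scaledLaplacian, ← mulVec_mulVec, ← mulVec_mulVec, mulVec_diagonal, this]

/-- Along an eigenvector of the scaled Laplacian, synchronization is a static state feedback. -/
theorem modeCoord_syncStep {q : Fin N → ℝ} {κ : ℝ}
    (hq : ∀ i, q i * E.Γ E.τ i = κ) (γ α : ℝ) {u : Fin N → ℝ} {lam : ℝ}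
    (hu : E.scaledLaplacian *ᵥ u = lam • u) {x : Fin 2 × Fin N → ℝ} (hx : weighted q x = 0) :
    E.modeCoord u (E.syncStep q γ α (x, 0))
      = toLin' (feedbackMatrix (lam * γ) α E.τ) (E.modeCoord u x) := by
  have hΓ : ∀ i, 0 < √(E.Γ E.τ i) := fun i => Real.sqrt_pos.2 (E.Γ_pos E.τ_pos i)
  have hdev : E.syncStep q γ α (x, 0) = stackA E.τ (Fin N) *ᵥ x
      + stackB E.τ (Fin N) *ᵥ E.syncControl γ α (x, 0) := by
    rw [syncStep_apply]
    ext p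
    rw [deviation_apply, weighted_add, weighted_stackA, weighted_stackB, hx,
      E.dotProduct_syncControl hq]
    simp
  set f : Fin N → ℝ := fun i => gainRow γ α E.τ ⬝ᵥ fun a => x (a, i)
  have hη : ∀ i, E.syncControl γ α (x, 0) i = -(E.Γ E.τ i * (E.graph.lapMatrix ℝ *ᵥ f) i) := by
    intro i
    rw [syncControl_apply, lapMatrix_mulVec_eq, mul_neg, neg_neg]
    congr 1
    simp only [f, dotProduct, Fin.sum_univ_two, Finset.sum_sub_distrib, Finset.sum_add_distrib,
      ← Finset.mul_sum]
    simp
    ring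
  have hlap : ∀ i, (E.graph.lapMatrix ℝ *ᵥ fun j => √(E.Γ E.τ j) * u j) i
      = lam * (u i / √(E.Γ E.τ i)) := fun i => by
    have := congrFun hu i
    rw [scaledLaplacian_mulVec_apply, Pi.smul_apply, smul_eq_mul] at this
    rw [← mul_div_assoc, ← this, mul_div_cancel_left₀ _ (hΓ i).ne']
  -- Symmetry of the Laplacian moves it onto `D^{1/2} u`, where the eigenvector equation turns it
  -- into multiplication by `lam`; the eigenvalue is absorbed into the gain.
  have hin : (fun i => u i / √(E.Γ E.τ i)) ⬝ᵥ E.syncControl γ α (x, 0)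
      = -(gainRow (lam * γ) α E.τ ⬝ᵥ E.modeCoord u x) := by
    have h1 : (fun i => u i / √(E.Γ E.τ i)) ⬝ᵥ E.syncControl γ α (x, 0)
        = -((fun j => √(E.Γ E.τ j) * u j) ⬝ᵥ E.graph.lapMatrix ℝ *ᵥ f) := by
      simp only [dotProduct, hη, ← Finset.sum_neg_distrib]
      refine Finset.sum_congr rfl fun i _ => ?_
      nth_rewrite 2 [← Real.mul_self_sqrt (E.Γ_pos E.τ_pos i).le]
      field_simp [(hΓ i).ne']
    rw [h1, dotProduct_lapMatrix_comm]
    simp only [dotProduct, hlap, f, modeCoord, Fin.sum_univ_two, gainRow, Pi.smul_apply,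
      smul_eq_mul, mul_add, Finset.mul_sum, Finset.sum_add_distrib]
    congr 2 <;> exact Finset.sum_congr rfl fun i _ => by ring
  rw [hdev, modeCoord_eq_weighted, weighted_add, weighted_stackA, weighted_stackB, hin,
    toLin'_apply, feedbackMatrix, sub_mulVec, ← modeCoord_eq_weighted, vecMulVec_mulVec]
  ext a
  simp only [Pi.add_apply, Pi.sub_apply, Pi.smul_apply, smul_eq_mul, MulOpposite.smul_eq_mul_unop,
    MulOpposite.unop_op]
  ring

theorem weighted_syncStep {q : Fin N → ℝ} (hq1 : ∑ i, q i = 1) (γ α : ℝ)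
    (s : (Fin 2 × Fin N → ℝ) × (∀ i : Fin N, Fin 2 × E.Nbr i → ℝ)) :
    weighted q (E.syncStep q γ α s) = 0 :=
  weighted_deviation hq1 _

/-- The noise-free deviation from the ensemble mean vanishes asymptotically. -/
theorem syncStep_stable {q : Fin N → ℝ} (hq1 : ∑ i, q i = 1) {κ : ℝ}
    (hq : ∀ i, q i * E.Γ E.τ i = κ) {γ α : ℝ} (hα : 0 < α)
    (hγ : 0 < γ ∧ γ < 4 / (2 + α) * (lambdaMax E.scaledLaplacian)⁻¹) (x : Fin 2 × Fin N → ℝ) :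
    Tendsto (fun k => ((E.syncStep q γ α ∘ₗ LinearMap.inl ℝ _ _) ^ k) x) atTop (𝓝 0) := by
  set A := E.syncStep q γ α ∘ₗ LinearMap.inl ℝ _ _ with hA
  have hΓ : ∀ i, 0 < √(E.Γ E.τ i) := fun i => Real.sqrt_pos.2 (E.Γ_pos E.τ_pos i)
  have hS := E.scaledLaplacian_posSemidef
  have hSH := hS.isHermitian
  have hκ : κ ≠ 0 := by
    rintro rfl
    have : ∀ i, q i = 0 := fun i => by simpa [(E.Γ_pos E.τ_pos i).ne'] using hq i
    simp [this] at hq1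
  have hmax : 0 < lambdaMax E.scaledLaplacian := by
    have h4 : 0 < 4 / (2 + α) * (lambdaMax E.scaledLaplacian)⁻¹ := hγ.1.trans hγ.2
    exact inv_pos.1 ((pos_iff_pos_of_mul_pos h4).1 (by positivity))
  have hle : ∀ n, hSH.eigenvalues n ≤ lambdaMax E.scaledLaplacian := fun n =>
    le_csSup finite_real_spectrum.bddAbove (hSH.eigenvalues_mem_spectrum_real n)
  -- The shift by one matters: `x` is arbitrary, and only after one step does the state have zero
  -- `q`-mean.
  let y : Fin N → ℕ → Fin 2 → ℝ := fun n k => E.modeCoord (hSH.eigenvectorBasis n) ((A ^ (k + 1)) x)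
  have hw : ∀ k, weighted q ((A ^ (k + 1)) x) = 0 := fun k => by
    rw [pow_succ']
    exact E.weighted_syncStep hq1 γ α _
  have hy : ∀ n k, y n k = (toLin' (feedbackMatrix (hSH.eigenvalues n * γ) α E.τ) ^ k) (y n 0) := by
    intro n k
    induction k with
    | zero => simp
    | succ k ih =>
      rw [pow_succ', Module.End.mul_apply, ← ih]
      simp only [y]
      rw [pow_succ', Module.End.mul_apply]
      exact E.modeCoord_syncStep hq γ α (hSH.mulVec_eigenvectorBasis n) (hw k)
  have hlim : ∀ n, Tendsto (y n) atTop (𝓝 0) := by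
    intro n
    rcases (hS.eigenvalues_nonneg n).eq_or_lt' with h0 | hpos
    · have hz : ∀ k, y n k = 0 := by
        set u : Fin N → ℝ := ⇑(hSH.eigenvectorBasis n)
        have hu : E.scaledLaplacian *ᵥ u = 0 := by
          rw [hSH.mulVec_eigenvectorBasis n, h0, zero_smul]
        have hker : E.graph.lapMatrix ℝ *ᵥ (fun j => √(E.Γ E.τ j) * u j) = 0 := by
          ext i
          have := congrFun hu i
          rw [scaledLaplacian_mulVec_apply] at this
          simpa [(hΓ i).ne'] using this
        rw [SimpleGraph.lapMatrix_mulVec_eq_zero_iff_forall_reachable] at hker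
        intro k
        ext a
        have h1 := congrFun (hw k) a
        simp only [weighted, Pi.zero_apply] at h1
        have hN : Nonempty (Fin N) := E.connected.nonempty
        obtain ⟨i₀⟩ := hN
        -- Connectedness makes `D^{1/2} u` constant, so the covector of the zero mode is
        -- proportional to `q` and vanishes on states with zero mean.
        have h2 : ∀ i, u i / √(E.Γ E.τ i) = √(E.Γ E.τ i₀) * u i₀ / κ * q i := fun i => by
          have h3 := hker i i₀ (E.connected.preconnected i i₀)
          have h4 : κ / E.Γ E.τ i = q i := by
            rw [← hq i, mul_div_cancel_right₀ _ (E.Γ_pos E.τ_pos i).ne']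
          rw [← h4, ← h3]
          nth_rewrite 3 [← Real.mul_self_sqrt (E.Γ_pos E.τ_pos i).le]
          field_simp [(hΓ i).ne']
        simp only [y, modeCoord]
        simp only [u] at h2
        simp only [h2, mul_assoc, ← Finset.mul_sum, h1]
        simp
      exact (tendsto_congr hz).2 tendsto_const_nhds
    · refine (tendsto_congr (hy n)).2 ?_
      refine feedbackMatrix_stable E.τ_pos (mul_pos hpos hγ.1) ?_ hα _
      calc hSH.eigenvalues n * γ ≤ lambdaMax E.scaledLaplacian * γ :=
            mul_le_mul_of_nonneg_right (hle n) hγ.1.le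
        _ < lambdaMax E.scaledLaplacian * (4 / (2 + α) * (lambdaMax E.scaledLaplacian)⁻¹) :=
            mul_lt_mul_of_pos_left hγ.2 hmax
        _ = 4 / (2 + α) := by field_simp
  rw [← tendsto_add_atTop_iff_nat 1, tendsto_pi_nhds]
  rintro ⟨a, i⟩
  have hrec : ∀ k, ((A ^ (k + 1)) x) (a, i)
      = √(E.Γ E.τ i) * ∑ n, (hSH.eigenvectorBasis n) i * y n k a := fun k => by
    have hUU : ∀ j, ∑ n, (hSH.eigenvectorBasis n) i * (hSH.eigenvectorBasis n) j
        = if i = j then 1 else 0 := fun j => by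
      have := congrFun (congrFun (Unitary.coe_mul_star_self hSH.eigenvectorUnitary) i) j
      simpa [Matrix.mul_apply, one_apply, star_apply] using this
    simp only [y, modeCoord, Finset.mul_sum]
    rw [Finset.sum_comm]
    have : ∀ j, ∑ n, √(E.Γ E.τ i) * ((hSH.eigenvectorBasis n) i *
        ((hSH.eigenvectorBasis n) j / √(E.Γ E.τ j) * ((A ^ (k + 1)) x) (a, j)))
        = if i = j then ((A ^ (k + 1)) x) (a, i) else 0 := fun j => by
      calc _ = (√(E.Γ E.τ i) / √(E.Γ E.τ j) * ((A ^ (k + 1)) x) (a, j)) *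
            ∑ n, (hSH.eigenvectorBasis n) i * (hSH.eigenvectorBasis n) j := by
              rw [Finset.mul_sum]
              exact Finset.sum_congr rfl fun n _ => by ring
        _ = _ := by
          rw [hUU]
          split_ifs with h
          · subst h
            rw [div_self (hΓ i).ne']
            ring
          · ring
    simp [this]
  simp only [hrec]
  have := (tendsto_finsetSum Finset.univ fun n _ =>
    (tendsto_pi_nhds.1 (hlim n) a).const_mul ((hSH.eigenvectorBasis n) i)).const_mul √(E.Γ E.τ i)
  simpa using this

end ClockEnsemble

/-! ### Moving averages of Gaussian white noise -/

section WhiteNoise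

variable {Ω : Type*} [MeasurableSpace Ω] {μ : Measure Ω} {ι : Type*}

/-- Vector-valued Gaussian white noise with covariance matrix `S`. -/
structure IsGaussianWhiteNoise (μ : Measure Ω) (n : ℕ → Ω → ι → ℝ) (S : Matrix ι ι ℝ) : Prop where
  gaussian : IsGaussianProcess (fun (t : ℕ × ι) ω => n t.1 ω t.2) μ
  mean : ∀ k p, ∫ ω, n k ω p ∂μ = 0
  cov : ∀ k l p q, cov[fun ω => n k ω p, fun ω => n l ω q; μ] = if k = l then S p q else 0

namespace IsGaussianWhiteNoise

variable {n : ℕ → Ω → ι → ℝ} {S : Matrix ι ι ℝ}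

theorem shift (h : IsGaussianWhiteNoise μ n S) (k₀ : ℕ) :
    IsGaussianWhiteNoise μ (fun k => n (k₀ + k)) S where
  gaussian := h.gaussian.comp_right fun t : ℕ × ι => (k₀ + t.1, t.2)
  mean _ p := h.mean _ p
  cov k l p q := by simp [h.cov]

theorem memLp (h : IsGaussianWhiteNoise μ n S) (k : ℕ) (p : ι) :
    MemLp (fun ω => n k ω p) 2 μ :=
  (h.gaussian.hasGaussianLaw_eval (k, p)).memLp_two

variable [Fintype ι]

theorem memLp_dotProduct (h : IsGaussianWhiteNoise μ n S) (k : ℕ) (ξ : ι → ℝ) :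
    MemLp (fun ω => ξ ⬝ᵥ n k ω) 2 μ :=
  memLp_finsetSum _ fun p _ => (h.memLp k p).const_mul (ξ p)

theorem memLp_sum (h : IsGaussianWhiteNoise μ n S) (K : ℕ) (ξ : ℕ → ι → ℝ) :
    MemLp (fun ω => ∑ k ∈ Finset.range K, ξ k ⬝ᵥ n k ω) 2 μ :=
  memLp_finsetSum _ fun k _ => h.memLp_dotProduct k (ξ k)

theorem integral_sum (h : IsGaussianWhiteNoise μ n S) [IsProbabilityMeasure μ] (a : ℝ) (K : ℕ)
    (ξ : ℕ → ι → ℝ) : ∫ ω, (a + ∑ k ∈ Finset.range K, ξ k ⬝ᵥ n k ω) ∂μ = a := by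
  have hint := fun k p => (h.memLp k p).integrable one_le_two
  have h0 : ∀ k, ∫ ω, ξ k ⬝ᵥ n k ω ∂μ = 0 := fun k => by
    simp only [dotProduct]
    rw [integral_finsetSum _ fun p _ => (hint k p).const_mul _]
    simp [integral_const_mul, h.mean]
  rw [integral_add (integrable_const a) ((h.memLp_sum K ξ).integrable one_le_two),
    integral_finsetSum _ fun k _ => (h.memLp_dotProduct k (ξ k)).integrable one_le_two]
  simp [h0]

theorem cov_sum (h : IsGaussianWhiteNoise μ n S) [IsProbabilityMeasure μ] (a a' : ℝ) {K K' : ℕ}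
    (hK : K ≤ K') (ξ ξ' : ℕ → ι → ℝ) :
    cov[fun ω => a + ∑ k ∈ Finset.range K, ξ k ⬝ᵥ n k ω,
      fun ω => a' + ∑ k ∈ Finset.range K', ξ' k ⬝ᵥ n k ω; μ]
      = ∑ k ∈ Finset.range K, ξ k ⬝ᵥ S *ᵥ ξ' k := by
  have hkl : ∀ k l, cov[fun ω => ξ k ⬝ᵥ n k ω, fun ω => ξ' l ⬝ᵥ n l ω; μ]
      = if k = l then ξ k ⬝ᵥ S *ᵥ ξ' l else 0 := fun k l => by
    simp only [dotProduct]
    rw [covariance_fun_sum_fun_sum (fun p => (h.memLp k p).const_mul (ξ k p))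
      (fun q => (h.memLp l q).const_mul (ξ' l q))]
    simp only [covariance_const_mul_left, covariance_const_mul_right, h.cov]
    split_ifs with hkl
    · simp only [mulVec, dotProduct, Finset.mul_sum]
      exact Finset.sum_congr rfl fun p _ => Finset.sum_congr rfl fun q _ => by ring
    · simp
  rw [covariance_const_add_left ((h.memLp_sum K ξ).integrable one_le_two),
    covariance_const_add_right ((h.memLp_sum K' ξ').integrable one_le_two),
    covariance_fun_sum_fun_sum' (fun k _ => h.memLp_dotProduct k (ξ k))
      (fun k _ => h.memLp_dotProduct k (ξ' k))]
  refine Finset.sum_congr rfl fun k hk => ?_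
  simp only [hkl, Finset.sum_ite_eq]
  rw [if_pos (Finset.mem_range.2 ((Finset.mem_range.1 hk).trans_le hK))]

theorem isGaussianProcess_sum (h : IsGaussianWhiteNoise μ n S) {T : Type*} (a : T → ℝ) (K : T → ℕ)
    (ξ : T → ℕ → ι → ℝ) :
    IsGaussianProcess (fun t ω => a t + ∑ k ∈ Finset.range (K t), ξ t k ⬝ᵥ n k ω) μ := by
  have h0 : IsGaussianProcess (fun t ω => ∑ k ∈ Finset.range (K t), ξ t k ⬝ᵥ n k ω) μ := by
    refine IsGaussianProcess.of_isGaussianProcess h.gaussian fun t => ⟨Finset.range (K t) ×ˢ Finset.univ,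
      ∑ s : (Finset.range (K t) ×ˢ (Finset.univ : Finset ι) : Finset (ℕ × ι)),
        ξ t s.1.1 s.1.2 • ContinuousLinearMap.proj (R := ℝ) (φ := fun _ => ℝ) s, fun ω => ?_⟩
    simp only [FunLike.coe_sum, FunLike.coe_smul, Finset.sum_apply, Pi.smul_apply,
      ContinuousLinearMap.proj_apply, smul_eq_mul, Finset.restrict]
    rw [Finset.sum_coe_sort (Finset.range (K t) ×ˢ (Finset.univ : Finset ι))
      (fun s => ξ t s.1 s.2 * n s.1 ω s.2), Finset.sum_product]
    rfl
  refine ⟨fun I => ⟨?_⟩⟩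
  have hI := (h0.hasGaussianLaw I).isGaussian_map
  have hm := (h0.hasGaussianLaw I).aemeasurable
  have : (μ.map fun ω => I.restrict fun t => a t + ∑ k ∈ Finset.range (K t), ξ t k ⬝ᵥ n k ω)
      = (μ.map fun ω => I.restrict fun t => ∑ k ∈ Finset.range (K t), ξ t k ⬝ᵥ n k ω).map
        (fun x => I.restrict a + x) := by
    rw [AEMeasurable.map_map_of_aemeasurable (by fun_prop) hm]
    rfl
  rw [this]
  infer_instance

variable [DecidableEq ι]

/-- Coefficients of a component of a vector-valued linear map. -/
def coeffVec (g : (ι → ℝ) →ₗ[ℝ] (Fin 2 → ℝ)) (a : Fin 2) : ι → ℝ :=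
  fun p => g (Pi.single p 1) a

theorem coeffVec_dotProduct (g : (ι → ℝ) →ₗ[ℝ] (Fin 2 → ℝ)) (a : Fin 2) (x : ι → ℝ) :
    coeffVec g a ⬝ᵥ x = g x a := by
  have hx : x = ∑ p, x p • (Pi.single p 1 : ι → ℝ) := by
    ext q
    simp [Finset.sum_apply, Pi.single_apply]
  conv_rhs => rw [hx]
  simp [coeffVec, dotProduct, mul_comm]

theorem movingAverage_eq (g : ℕ → (ι → ℝ) →ₗ[ℝ] (Fin 2 → ℝ)) (x : ℕ → ι → ℝ) (K : ℕ) (a : Fin 2) :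
    (∑ i ∈ Finset.range K, g i (x (K - 1 - i))) a
      = ∑ k ∈ Finset.range K, coeffVec (g (K - 1 - k)) a ⬝ᵥ x k := by
  rw [Finset.sum_apply, ← Finset.sum_range_reflect]
  refine Finset.sum_congr rfl fun k hk => ?_
  have := Finset.mem_range.1 hk
  rw [coeffVec_dotProduct, show K - 1 - (K - 1 - k) = k by omega]

variable {g : ℕ → (ι → ℝ) →ₗ[ℝ] (Fin 2 → ℝ)} {Y : ℕ → Ω → Fin 2 → ℝ} {m : ℕ → Fin 2 → ℝ} {l : ℕ}

theorem movingAverage_apply {Ω : Type*} {n : ℕ → Ω → ι → ℝ} {Y : ℕ → Ω → Fin 2 → ℝ}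
    (hY : ∀ K ω, Y K ω = m K + ∑ i ∈ Finset.range (K * l), g i (n (K * l - 1 - i) ω))
    (K : ℕ) (ω : Ω) (a : Fin 2) : Y K ω a
      = m K a + ∑ k ∈ Finset.range (K * l), coeffVec (g (K * l - 1 - k)) a ⬝ᵥ n k ω := by
  rw [hY, Pi.add_apply, movingAverage_eq g fun k => n k ω]

theorem cov_movingAverage (h : IsGaussianWhiteNoise μ n S) [IsProbabilityMeasure μ]
    (hY : ∀ K ω, Y K ω = m K + ∑ i ∈ Finset.range (K * l), g i (n (K * l - 1 - i) ω))
    (K d : ℕ) (a b : Fin 2) :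
    cov[fun ω => Y K ω a, fun ω => Y (K + d) ω b; μ]
      = ∑ i ∈ Finset.range (K * l), coeffVec (g i) a ⬝ᵥ S *ᵥ coeffVec (g (i + d * l)) b := by
  simp only [movingAverage_apply hY]
  rw [h.cov_sum _ _ (Nat.mul_le_mul_right l (Nat.le_add_right K d)), ← Finset.sum_range_reflect]
  refine Finset.sum_congr rfl fun k hk => ?_
  have := Finset.mem_range.1 hk
  rw [show K * l - 1 - (K * l - 1 - k) = k by omega, add_mul,
    show K * l + d * l - 1 - (K * l - 1 - k) = k + d * l by omega]

theorem mean_movingAverage (h : IsGaussianWhiteNoise μ n S) [IsProbabilityMeasure μ]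
    (hY : ∀ K ω, Y K ω = m K + ∑ i ∈ Finset.range (K * l), g i (n (K * l - 1 - i) ω))
    (K : ℕ) (a : Fin 2) : ∫ ω, Y K ω a ∂μ = m K a := by
  simp only [movingAverage_apply hY]
  exact h.integral_sum _ _ _

/-- A moving average of white noise with summable coefficients and vanishing mean is stationary
Gaussian in steady state. -/
theorem isSteadyStationaryGaussian (h : IsGaussianWhiteNoise μ n S) [IsProbabilityMeasure μ]
    (hl : 1 ≤ l)
    (hY : ∀ K ω, Y K ω = m K + ∑ i ∈ Finset.range (K * l), g i (n (K * l - 1 - i) ω))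
    (hm : Tendsto m atTop (𝓝 0)) (hg : ∀ x, Summable fun i => ‖g i x‖) :
    IsSteadyStationaryGaussian μ Y where
  gaussian := by
    simp only [movingAverage_apply hY]
    exact h.isGaussianProcess_sum (fun t : ℕ × Fin 2 => m t.1 t.2) (fun t => t.1 * l)
      (fun t k => coeffVec (g (t.1 * l - 1 - k)) t.2)
  mean a := by
    simp only [h.mean_movingAverage hY]
    exact tendsto_pi_nhds.1 hm a
  cov := by
    have hc : ∀ a p, Summable fun i => |coeffVec (g i) a p| := fun a p =>
      Summable.of_nonneg_of_le (fun _ => abs_nonneg _)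
        (fun i => norm_le_pi_norm (g i (Pi.single p 1)) a) (hg (Pi.single p 1))
    have hsum : ∀ d a b,
        Summable fun i => coeffVec (g i) a ⬝ᵥ S *ᵥ coeffVec (g (i + d * l)) b := by
      intro d a b
      simp only [dotProduct, mulVec, Finset.mul_sum]
      refine summable_sum fun p _ => summable_sum fun q _ => ?_
      refine Summable.of_norm_bounded
        (g := fun i => |coeffVec (g i) a p| * (|S p q| * ∑' j, |coeffVec (g j) b q|))
        ((hc a p).mul_right _) fun i => ?_
      rw [Real.norm_eq_abs, abs_mul, abs_mul]
      gcongr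
      exact (hc b q).le_tsum (i + d * l) fun _ _ => abs_nonneg _
    refine ⟨fun d a b => ∑' i, coeffVec (g i) a ⬝ᵥ S *ᵥ coeffVec (g (i + d * l)) b,
      fun d a b => ?_⟩
    simp only [h.cov_movingAverage hY]
    exact (hsum d a b).hasSum.tendsto_sum_nat.comp
      (tendsto_id.atTop_mul_const' (by omega))

/-- A moving average of nondegenerate white noise which is stationary Gaussian in steady state has
vanishing mean and vanishing coefficients. -/
theorem tendsto_zero_of_isSteadyStationaryGaussian (h : IsGaussianWhiteNoise μ n S)
    [IsProbabilityMeasure μ] (hS : ∀ y, y ≠ 0 → 0 < y ⬝ᵥ S *ᵥ y) (hl : 1 ≤ l)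
    (hY : ∀ K ω, Y K ω = m K + ∑ i ∈ Finset.range (K * l), g i (n (K * l - 1 - i) ω))
    (hst : IsSteadyStationaryGaussian μ Y) :
    Tendsto m atTop (𝓝 0) ∧ ∀ x, Tendsto (fun i => g i x) atTop (𝓝 0) := by
  constructor
  · rw [tendsto_pi_nhds]
    intro a
    exact (tendsto_congr fun K => h.mean_movingAverage hY K a).1 (hst.mean a)
  · intro x
    rw [tendsto_pi_nhds]
    intro a
    obtain ⟨c, hc⟩ := hst.cov
    have hlim := (tendsto_congr fun K => h.cov_movingAverage hY K 0 a a).1 (hc 0 a a)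
    simp only [zero_mul, add_zero] at hlim
    have hnn : ∀ i, 0 ≤ coeffVec (g i) a ⬝ᵥ S *ᵥ coeffVec (g i) a := fun i => by
      rcases eq_or_ne (coeffVec (g i) a) 0 with h0 | h0
      · simp [h0]
      · exact (hS _ h0).le
    obtain ⟨B, hB⟩ := hlim.bddAbove_range
    -- The lag-zero covariance is a partial sum of nonnegative terms; being convergent, it bounds
    -- them all.
    have hsum : Summable fun i => coeffVec (g i) a ⬝ᵥ S *ᵥ coeffVec (g i) a := by
      refine summable_of_sum_range_le (c := B) hnn fun K => ?_
      refine le_trans ?_ (hB ⟨K, rfl⟩)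
      exact Finset.sum_le_sum_of_subset_of_nonneg
        (Finset.range_subset_range.2 (Nat.le_mul_of_pos_right K hl)) fun i _ _ => hnn i
    have h0 := tendsto_zero_of_quadraticForm hS hsum.tendsto_atTop_zero
    have := tendsto_finsetSum Finset.univ fun p _ => (tendsto_pi_nhds.1 h0 p).mul_const (x p)
    simp only [Pi.zero_apply, zero_mul, Finset.sum_const_zero] at this
    exact (tendsto_congr fun i => coeffVec_dotProduct (g i) a x).1 this

end IsGaussianWhiteNoise

end WhiteNoise

/-! ### Minimizers of the Allan variance -/

namespace ClockEnsemble

variable {N : ℕ} (E : ClockEnsemble N) {Ω : Type*}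

/-- The noise of time `k + j` first appears in the state at `k + j + 1`, which leaves its frequency
part `m - 1 - j` steps to accumulate in the phase. -/
theorem freeRun_add (v : ℕ → Ω → Fin 2 × Fin N → ℝ) (q : Fin N → ℝ) (r₀ : Fin 2 → ℝ) (ω : Ω)
    (k m : ℕ) :
    E.freeRun v q r₀ (k + m) ω 0 = E.freeRun v q r₀ k ω 0 + m * E.τ * E.freeRun v q r₀ k ω 1
        + ∑ j ∈ Finset.range m, (weighted q (v (k + j) ω) 0
          + ((m : ℝ) - 1 - j) * E.τ * weighted q (v (k + j) ω) 1) ∧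
      E.freeRun v q r₀ (k + m) ω 1 = E.freeRun v q r₀ k ω 1
        + ∑ j ∈ Finset.range m, weighted q (v (k + j) ω) 1 := by
  induction m with
  | zero => simp
  | succ m ih =>
    rw [← add_assoc, freeRun, Pi.add_apply, Pi.add_apply, clockA_mulVec, Finset.sum_range_succ,
      Finset.sum_range_succ]
    simp only [cons_val_zero, cons_val_one, ih.1, ih.2]
    constructor
    · push_cast
      rw [mul_add, Finset.mul_sum]
      have : ∑ j ∈ Finset.range m, (weighted q (v (k + j) ω) 0
            + ((m : ℝ) + 1 - 1 - j) * E.τ * weighted q (v (k + j) ω) 1)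
          = ∑ j ∈ Finset.range m, (weighted q (v (k + j) ω) 0
            + ((m : ℝ) - 1 - j) * E.τ * weighted q (v (k + j) ω) 1)
          + ∑ j ∈ Finset.range m, E.τ * weighted q (v (k + j) ω) 1 := by
        rw [← Finset.sum_add_distrib]
        exact Finset.sum_congr rfl fun j _ => by ring
      rw [this]
      ring
    · ring

/-- Second differences of the phase of the free-running dynamics. -/
theorem freeRun_second_difference (v : ℕ → Ω → Fin 2 × Fin N → ℝ) (q : Fin N → ℝ)
    (r₀ : Fin 2 → ℝ) (ω : Ω) (k m : ℕ) :
    E.freeRun v q r₀ (k + 2 * m) ω 0 - 2 * E.freeRun v q r₀ (k + m) ω 0 + E.freeRun v q r₀ k ω 0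
      = ∑ j ∈ Finset.range m, (-weighted q (v (k + j) ω) 0
          + ((j : ℝ) + 1) * E.τ * weighted q (v (k + j) ω) 1)
        + ∑ j ∈ Finset.range m, (weighted q (v (k + (m + j)) ω) 0
          + ((m : ℝ) - 1 - j) * E.τ * weighted q (v (k + (m + j)) ω) 1) := by
  have h1 := E.freeRun_add v q r₀ ω k m
  have h2 := (E.freeRun_add v q r₀ ω (k + m) m).1
  rw [show k + 2 * m = k + m + m by ring, h2, h1.2]
  have h3 : ∑ j ∈ Finset.range m, (-weighted q (v (k + j) ω) 0
          + ((j : ℝ) + 1) * E.τ * weighted q (v (k + j) ω) 1)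
      = m * E.τ * ∑ j ∈ Finset.range m, weighted q (v (k + j) ω) 1
        - ∑ j ∈ Finset.range m, (weighted q (v (k + j) ω) 0
          + ((m : ℝ) - 1 - j) * E.τ * weighted q (v (k + j) ω) 1) := by
    rw [Finset.mul_sum, ← Finset.sum_sub_distrib]
    exact Finset.sum_congr rfl fun j _ => by ring
  rw [h3]
  simp only [add_assoc k m]
  rw [mul_add]
  linarith [h1.1]

variable [MeasurableSpace Ω] {μ : Measure Ω} {E} {v : ℕ → Ω → Fin 2 × Fin N → ℝ}
  {w : ℕ → Ω → E.graph.Dart → ℝ}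

theorem IsNoise.process (h : E.IsNoise μ v w) : IsGaussianWhiteNoise μ v E.Q where
  gaussian := h.gaussian.comp_right fun t : ℕ × (Fin 2 × Fin N) => (t.1, Sum.inl t.2)
  mean := h.mean_v
  cov := h.cov_v

/-- The joint covariance of process and measurement noise. -/
def noiseCov (E : ClockEnsemble N) :
    Matrix ((Fin 2 × Fin N) ⊕ E.graph.Dart) ((Fin 2 × Fin N) ⊕ E.graph.Dart) ℝ :=
  fromBlocks E.Q 0 0 (E.R • 1)

theorem IsNoise.joint (h : E.IsNoise μ v w) :
    IsGaussianWhiteNoise μ (fun k ω => Sum.elim (v k ω) (w k ω)) E.noiseCov where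
  gaussian := h.gaussian
  mean k p := by
    rcases p with p | d
    · exact h.mean_v k p
    · exact h.mean_w k d
  cov k l p q := by
    rcases p with p | d <;> rcases q with q | d'
    · simpa [noiseCov] using h.cov_v k l p q
    · simpa [noiseCov] using h.cov_vw k l p d'
    · simpa [noiseCov, covariance_comm] using h.cov_vw l k q d
    · simp only [Sum.elim_inr, h.cov_w, noiseCov, fromBlocks_apply₂₂, Matrix.smul_apply, one_apply,
        smul_eq_mul]
      split_ifs <;> simp_all

theorem noiseCov_pos (E : ClockEnsemble N) (y : (Fin 2 × Fin N) ⊕ E.graph.Dart → ℝ) (hy : y ≠ 0) :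
    0 < y ⬝ᵥ E.noiseCov *ᵥ y := by
  have hsplit : y ⬝ᵥ E.noiseCov *ᵥ y = (y ∘ Sum.inl) ⬝ᵥ E.Q *ᵥ (y ∘ Sum.inl)
      + E.R * ((y ∘ Sum.inr) ⬝ᵥ (y ∘ Sum.inr)) := by
    rw [noiseCov, fromBlocks_mulVec]
    simp [dotProduct, Fintype.sum_sum_type, smul_mulVec, Finset.mul_sum, mul_left_comm]
  have hR := E.R_pos
  rw [hsplit]
  have h2 : 0 ≤ (y ∘ Sum.inr) ⬝ᵥ (y ∘ Sum.inr) :=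
    Finset.sum_nonneg fun i _ => mul_self_nonneg _
  rcases eq_or_ne (y ∘ Sum.inl) 0 with h0 | h0
  · have h3 : y ∘ Sum.inr ≠ 0 := fun h3 => hy (funext fun s => by
      rcases s with s | s
      · exact congrFun h0 s
      · exact congrFun h3 s)
    have h4 : (y ∘ Sum.inr) ⬝ᵥ (y ∘ Sum.inr) ≠ 0 := fun h4 => h3 (dotProduct_self_eq_zero.1 h4)
    rw [h0]
    simpa using mul_pos hR (h2.lt_of_ne' h4)
  · have := E.Q_pos _ h0
    positivity

theorem sum_range_quadratic (m : ℕ) :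
    ∑ j ∈ Finset.range m, (2 / 3 + 2 * (j : ℝ) ^ 2 + 2 * j) = 2 / 3 * (m : ℝ) ^ 3 := by
  induction m with
  | zero => simp
  | succ m ih =>
    rw [Finset.sum_range_succ, ih]
    push_cast
    ring

/-- The second difference cancels the initial state and is a weighted sum of `2m` independent noise
vectors with coefficients `b`; its variance is `2 ∑ qᵢ² Γᵢ(mτ)`, independent of `r₀` and `k`. -/
theorem allanVar_eq [IsProbabilityMeasure μ] (h : IsGaussianWhiteNoise μ v E.Q) (q : Fin N → ℝ)
    (r₀ : Fin 2 → ℝ) (m k : ℕ) :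
    E.allanVar μ v q r₀ m k
      = (∑ i, q i ^ 2 * E.Γ (m * E.τ) i) * 2 / (2 * ((m : ℝ) * E.τ) ^ 2) := by
  let b : ℕ → Fin 2 → ℝ := fun j =>
    if j < m then ![-1, ((j : ℝ) + 1) * E.τ] else ![1, (2 * (m : ℝ) - 1 - j) * E.τ]
  let ξ : ℕ → Fin 2 × Fin N → ℝ := fun j p => b j p.1 * q p.2
  have hξ : ∀ j x, ξ j ⬝ᵥ x = b j 0 * weighted q x 0 + b j 1 * weighted q x 1 := fun j x => by
    simp only [ξ, dotProduct, Fintype.sum_prod_type, Fin.sum_univ_two, weighted, Finset.mul_sum,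
      mul_assoc]
  have hsh := h.shift k
  have hdiff : ∀ ω, (clockC ⬝ᵥ E.freeRun v q r₀ (k + 2 * m) ω
        - clockC ⬝ᵥ E.freeRun v q r₀ (k + m) ω)
      - (clockC ⬝ᵥ E.freeRun v q r₀ (k + m) ω - clockC ⬝ᵥ E.freeRun v q r₀ k ω)
      = 0 + ∑ j ∈ Finset.range (m + m), ξ j ⬝ᵥ v (k + j) ω := fun ω => by
    have hC : ∀ z, clockC ⬝ᵥ z = z 0 := fun z => by simp [clockC, dotProduct]
    simp only [hC]
    have := E.freeRun_second_difference v q r₀ ω k m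
    rw [zero_add, Finset.sum_range_add]
    have e1 : ∑ j ∈ Finset.range m, ξ j ⬝ᵥ v (k + j) ω
        = ∑ j ∈ Finset.range m, (-weighted q (v (k + j) ω) 0
          + ((j : ℝ) + 1) * E.τ * weighted q (v (k + j) ω) 1) :=
      Finset.sum_congr rfl fun j hj => by
        rw [hξ]
        simp [b, Finset.mem_range.1 hj]
    have e2 : ∑ j ∈ Finset.range m, ξ (m + j) ⬝ᵥ v (k + (m + j)) ω
        = ∑ j ∈ Finset.range m, (weighted q (v (k + (m + j)) ω) 0
          + ((m : ℝ) - 1 - j) * E.τ * weighted q (v (k + (m + j)) ω) 1) :=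
      Finset.sum_congr rfl fun j _ => by
        rw [hξ]
        have hb : b (m + j) = ![1, ((m : ℝ) - 1 - j) * E.τ] := by
          simp only [b, Nat.not_lt.2 (Nat.le_add_right m j), if_false]
          push_cast
          ring_nf
        simp [hb]
    rw [e1, e2, ← this]
    ring
  have hcov := hsh.cov_sum 0 0 (le_refl (m + m)) ξ ξ
  have hmean := hsh.integral_sum 0 (m + m) ξ
  have hL2 : MemLp (fun ω => 0 + ∑ j ∈ Finset.range (m + m), ξ j ⬝ᵥ v (k + j) ω) 2 μ := by
    simpa using hsh.memLp_sum (m + m) ξ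
  rw [covariance_eq_sub hL2 hL2, hmean, mul_zero, sub_zero] at hcov
  have hquad : ∀ j, ξ j ⬝ᵥ E.Q *ᵥ ξ j = ∑ i, q i ^ 2 * (E.τ * E.σ₁ i ^ 2 * b j 0 ^ 2
      + E.τ * E.σ₂ i ^ 2 * ((E.τ / 2 * b j 0 + b j 1) ^ 2 + E.τ ^ 2 / 12 * b j 0 ^ 2)) := fun j => by
    rw [Q_quadraticForm]
    exact Finset.sum_congr rfl fun i _ => by simp only [ξ]; ring
  have hsum : ∑ j ∈ Finset.range (m + m), ξ j ⬝ᵥ E.Q *ᵥ ξ j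
      = (∑ i, q i ^ 2 * E.Γ (m * E.τ) i) * 2 := by
    simp only [hquad]
    rw [Finset.sum_comm, Finset.sum_mul]
    refine Finset.sum_congr rfl fun i _ => ?_
    rw [← Finset.mul_sum, mul_assoc]
    congr 1
    set F : Fin 2 → ℝ → ℝ := fun s x => E.τ * E.σ₁ i ^ 2 + E.τ * E.σ₂ i ^ 2 *
      ((E.τ / 2 + ![-1, 1] s * x * E.τ) ^ 2 + E.τ ^ 2 / 12) with hF
    rw [Finset.sum_range_add]
    have e1 : ∑ j ∈ Finset.range m, (E.τ * E.σ₁ i ^ 2 * b j 0 ^ 2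
        + E.τ * E.σ₂ i ^ 2 * ((E.τ / 2 * b j 0 + b j 1) ^ 2 + E.τ ^ 2 / 12 * b j 0 ^ 2))
        = ∑ j ∈ Finset.range m, F 0 (j + 1) :=
      Finset.sum_congr rfl fun j hj => by
        simp [b, F, Finset.mem_range.1 hj]
        left
        ring
    have e2 : ∑ j ∈ Finset.range m, (E.τ * E.σ₁ i ^ 2 * b (m + j) 0 ^ 2
        + E.τ * E.σ₂ i ^ 2 * ((E.τ / 2 * b (m + j) 0 + b (m + j) 1) ^ 2
          + E.τ ^ 2 / 12 * b (m + j) 0 ^ 2))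
        -- Reversing the second block pairs its terms with those of the first, and each pair sums to
        -- a polynomial in `j`.
        = ∑ j ∈ Finset.range m, F 1 j := by
      rw [← Finset.sum_range_reflect]
      refine Finset.sum_congr rfl fun j hj => ?_
      have hj' := Finset.mem_range.1 hj
      have hcast : ((m - 1 - j : ℕ) : ℝ) = m - 1 - j := by
        rw [Nat.cast_sub (by omega), Nat.cast_sub (by omega), Nat.cast_one]
      simp [b, F, hcast]
      left
      ring
    rw [e1, e2, ← Finset.sum_add_distrib]
    have e3 : ∀ j : ℕ, F 0 (j + 1) + F 1 j
        = 2 * E.τ * E.σ₁ i ^ 2 + E.τ ^ 3 * E.σ₂ i ^ 2 * (2 / 3 + 2 * (j : ℝ) ^ 2 + 2 * j) :=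
      fun j => by simp [F]; ring
    simp only [e3]
    rw [Finset.sum_add_distrib, ← Finset.mul_sum (Finset.range m) _ (E.τ ^ 3 * E.σ₂ i ^ 2), sum_range_quadratic]
    simp only [Finset.sum_const, Finset.card_range, nsmul_eq_mul, Γ]
    ring
  rw [allanVar]
  simp only [hdiff]
  rw [integral_div, ← hsum, ← hcov]
  congr 1
  exact integral_congr_ae (Eventually.of_forall fun ω => by simp [pow_two])

/-- The minimizer of the Allan variance weights the clocks inversely to `Γ`. -/
theorem IsAllanOptimal.eq [IsProbabilityMeasure μ] (h : IsGaussianWhiteNoise μ v E.Q) {m : ℕ}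
    (hm : 1 ≤ m) {q : Fin N → ℝ} (hq : E.IsAllanOptimal μ v m q) (i : Fin N) :
    q i = (∑ j, (E.Γ (m * E.τ) j)⁻¹)⁻¹ * (E.Γ (m * E.τ) i)⁻¹ := by
  have hτ := E.τ_pos
  have hT : 0 < (m : ℝ) * E.τ := mul_pos (by exact_mod_cast hm) E.τ_pos
  have hΓ := fun j => E.Γ_pos hT j
  set κ := (∑ j, (E.Γ (m * E.τ) j)⁻¹)⁻¹ with hκ
  set p : Fin N → ℝ := fun j => κ * (E.Γ (m * E.τ) j)⁻¹ with hp
  have hs : 0 < ∑ j, (E.Γ (m * E.τ) j)⁻¹ :=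
    Finset.sum_pos (fun j _ => inv_pos.2 (hΓ j)) ⟨i, Finset.mem_univ _⟩
  have hp1 : ∑ j, p j = 1 := by
    simp only [hp, ← Finset.mul_sum]
    exact inv_mul_cancel₀ hs.ne'
  have hle := hq.2 p hp1 0 0
  rw [allanVar_eq h, allanVar_eq h, div_le_div_iff_of_pos_right (by positivity)] at hle
  -- Pythagoras: `p Γ` is constant, so the cross term vanishes for weights of equal total, and the
  -- excess cost is a positive definite form in `q - p`.
  have hexp : ∑ j, q j ^ 2 * E.Γ (m * E.τ) j
      = ∑ j, p j ^ 2 * E.Γ (m * E.τ) j + ∑ j, (q j - p j) ^ 2 * E.Γ (m * E.τ) j := by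
    have hcross : ∑ j, 2 * κ * (q j - p j) = 0 := by
      rw [← Finset.mul_sum, Finset.sum_sub_distrib, hq.1, hp1, sub_self, mul_zero]
    rw [← add_zero (∑ j, (q j - p j) ^ 2 * _), ← hcross, ← Finset.sum_add_distrib,
      ← Finset.sum_add_distrib]
    refine Finset.sum_congr rfl fun j _ => ?_
    have : p j * E.Γ (m * E.τ) j = κ := by
      simp only [hp]
      rw [mul_assoc, inv_mul_cancel₀ (hΓ j).ne', mul_one]
    rw [← this]
    ring
  have h0 : ∑ j, (q j - p j) ^ 2 * E.Γ (m * E.τ) j = 0 :=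
    le_antisymm (by linarith) (Finset.sum_nonneg fun j _ => mul_nonneg (sq_nonneg _) (hΓ j).le)
  have := (Finset.sum_eq_zero_iff_of_nonneg fun j _ => mul_nonneg (sq_nonneg _) (hΓ j).le).1 h0 i
    (Finset.mem_univ _)
  simpa [(hΓ i).ne', sub_eq_zero] using this

end ClockEnsemble

/-! ### Error coordinates of the closed loop -/

namespace ClockEnsemble

variable {N : ℕ} {E : ClockEnsemble N}

/-- Differences of stacked states along a family of sub-edges. -/
def edgeDiff {m : Type} (d : m → E.graph.Dart) : (Fin 2 × Fin N → ℝ) →ₗ[ℝ] (Fin 2 × m → ℝ) where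
  toFun x p := x (p.1, (d p.2).snd) - x (p.1, (d p.2).fst)
  map_add' x y := by
    ext p
    simp only [Pi.add_apply]
    ring
  map_smul' r x := by
    ext p
    simp only [Pi.smul_apply, smul_eq_mul, RingHom.id_apply]
    ring

theorem edgeDiff_apply {m : Type} (d : m → E.graph.Dart) (x : Fin 2 × Fin N → ℝ) (p : Fin 2 × m) :
    edgeDiff d x p = x (p.1, (d p.2).snd) - x (p.1, (d p.2).fst) := rfl

theorem incidence_mulVec_add_const {m : Type} (d : m → E.graph.Dart) (η : Fin N → ℝ)
    (r : ℝ) :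
    incidence d *ᵥ (fun i => η i + r) = incidence d *ᵥ η := by
  ext e
  simp [incidence_mulVec]

section Estimator

variable {m : Type} [Fintype m] [DecidableEq m] (d : m → E.graph.Dart)

theorem edgeDiff_stackA (x : Fin 2 × Fin N → ℝ) :
    edgeDiff d (stackA E.τ (Fin N) *ᵥ x) = stackA E.τ m *ᵥ edgeDiff d x := by
  ext ⟨a, e⟩
  simp only [edgeDiff_apply, stackA_mulVec_apply, clockA_mulVec]
  fin_cases a <;> simp
  ring

theorem edgeDiff_stackB (η : Fin N → ℝ) :
    edgeDiff d (stackB E.τ (Fin N) *ᵥ η) = stackB E.τ m *ᵥ (incidence d *ᵥ η) := by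
  ext ⟨a, e⟩
  simp only [edgeDiff_apply, stackB_mulVec_apply, incidence_mulVec]
  ring

theorem innovation_eq (ζ : Fin 2 × m → ℝ) (x : Fin 2 × Fin N → ℝ) (w : E.graph.Dart → ℝ) :
    innovation d ζ x w = stackC m *ᵥ (edgeDiff d x - ζ) + w ∘ d := by
  ext e
  simp [innovation, measurement, stackC_mulVec_apply, edgeDiff_apply, clockC, dotProduct]
  ring

/-- Dynamics of the estimation error of an edge-state estimator. -/
theorem edgeDiff_sub_estimatorStep (H : Matrix (Fin 2 × m) m ℝ) (ζ : Fin 2 × m → ℝ)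
    (x v : Fin 2 × Fin N → ℝ) (η : Fin N → ℝ) (r : ℝ) (w : E.graph.Dart → ℝ) :
    edgeDiff d (stackA E.τ (Fin N) *ᵥ x + stackB E.τ (Fin N) *ᵥ (fun i => η i + r) + v)
        - estimatorStep d H ζ x η w
      = (stackA E.τ m - H * stackC m) *ᵥ (edgeDiff d x - ζ) + (edgeDiff d v - H *ᵥ (w ∘ d)) := by
  rw [map_add, map_add, edgeDiff_stackA, edgeDiff_stackB, incidence_mulVec_add_const,
    estimatorStep, innovation_eq, sub_mulVec, mulVec_add, mulVec_sub (stackA E.τ m),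
    ← mulVec_mulVec]
  abel

end Estimator

variable (E) in
/-- Deviations of the clocks from their mean, and errors of the edge-state estimators. -/
abbrev SyncError : Type :=
  ((Fin 2 × Fin N → ℝ) × (∀ i : Fin N, Fin 2 × E.Nbr i → ℝ)) × (Fin 2 × Fin (N - 1) → ℝ)

variable (E) in
/-- Index set of the joint process and measurement noise. -/
abbrev NoiseIndex : Type := (Fin 2 × Fin N) ⊕ E.graph.Dart

/-- The weighted mean as a linear map. -/
def weightedMap {m : Type*} [Fintype m] (q : m → ℝ) : (Fin 2 × m → ℝ) →ₗ[ℝ] (Fin 2 → ℝ) where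
  toFun := weighted q
  map_add' := weighted_add q
  map_smul' r s := weighted_smul q r s

theorem weightedMap_apply {m : Type*} [Fintype m] (q : m → ℝ) (s : Fin 2 × m → ℝ) :
    weightedMap q s = weighted q s := rfl

namespace Controller

variable (c : E.Controller)

/-- Noise-free dynamics of the synchronization and estimation errors. -/
def syncErrorStep : E.SyncError →ₗ[ℝ] E.SyncError :=
  ((E.syncStep c.qτ c.γs c.αs ∘ₗ LinearMap.fst ℝ _ _).prod
    ((LinearMap.pi fun i => toLin' (stackA E.τ (E.Nbr i) - c.H i * stackC (E.Nbr i)) ∘ₗ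
      LinearMap.proj i) ∘ₗ LinearMap.snd ℝ _ _ ∘ₗ LinearMap.fst ℝ _ _)).prod
    (toLin' (stackA E.τ (Fin (N - 1)) - c.Hf * stackC (Fin (N - 1))) ∘ₗ LinearMap.snd ℝ _ _)

theorem syncErrorStep_apply (e : E.SyncError) : c.syncErrorStep e
    = ((E.syncStep c.qτ c.γs c.αs e.1,
        fun i => (stackA E.τ (E.Nbr i) - c.H i * stackC (E.Nbr i)) *ᵥ e.1.2 i),
      (stackA E.τ (Fin (N - 1)) - c.Hf * stackC (Fin (N - 1))) *ᵥ e.2) := rfl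

/-- Dynamics of the supervisor's estimate of the gap under floating. -/
def floatStep (k : ℕ) : (Fin 2 → ℝ) →ₗ[ℝ] (Fin 2 → ℝ) :=
  toLin' (if c.ℓ ∣ k then clockA E.τ - vecMulVec (clockB E.τ) (gainRow c.γf c.αf c.T)
    else clockA E.τ)

/-- The injection of the innovation into the supervisor's estimate of the gap. -/
def gapGain : (Fin (N - 1) → ℝ) →ₗ[ℝ] (Fin 2 → ℝ) :=
  weightedMap c.gapRow ∘ₗ toLin' c.Hf

/-- Noise-free dynamics of the closed loop in error coordinates. -/
def errorStep (k : ℕ) : (E.SyncError × (Fin 2 → ℝ)) →ₗ[ℝ] (E.SyncError × (Fin 2 → ℝ)) :=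
  (c.syncErrorStep ∘ₗ LinearMap.fst ℝ _ _).prod
    (c.floatStep k ∘ₗ LinearMap.snd ℝ _ _
      + c.gapGain ∘ₗ toLin' (stackC (Fin (N - 1))) ∘ₗ LinearMap.snd ℝ _ _ ∘ₗ LinearMap.fst ℝ _ _)

theorem errorStep_apply (k : ℕ) (e : E.SyncError × (Fin 2 → ℝ)) : c.errorStep k e
    = (c.syncErrorStep e.1, c.floatStep k e.2 + c.gapGain (stackC (Fin (N - 1)) *ᵥ e.1.2)) := rfl

/-- Restriction of the joint noise to the measurements of a family of sub-edges. -/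
def dartNoise {m : Type} (d : m → E.graph.Dart) : (E.NoiseIndex → ℝ) →ₗ[ℝ] (m → ℝ) :=
  LinearMap.funLeft ℝ ℝ (Sum.inr ∘ d)

/-- Restriction of the joint noise to the process noise. -/
def processNoise : (E.NoiseIndex → ℝ) →ₗ[ℝ] (Fin 2 × Fin N → ℝ) :=
  LinearMap.funLeft ℝ ℝ Sum.inl

/-- The injection of the noise into the closed loop in error coordinates. -/
def noiseMap : (E.NoiseIndex → ℝ) →ₗ[ℝ] (E.SyncError × (Fin 2 → ℝ)) :=
  (((deviation c.qτ ∘ₗ processNoise).prod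
    (LinearMap.pi fun i => edgeDiff (E.nbrDart i) ∘ₗ processNoise
      - toLin' (c.H i) ∘ₗ dartNoise (E.nbrDart i))).prod
    (edgeDiff c.tree.edge ∘ₗ processNoise - toLin' c.Hf ∘ₗ dartNoise c.tree.edge)).prod
    (c.gapGain ∘ₗ dartNoise c.tree.edge)

theorem noiseMap_apply (v : Fin 2 × Fin N → ℝ) (w : E.graph.Dart → ℝ) :
    c.noiseMap (Sum.elim v w) = (((deviation c.qτ v,
        fun i => edgeDiff (E.nbrDart i) v - c.H i *ᵥ (w ∘ E.nbrDart i)),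
        edgeDiff c.tree.edge v - c.Hf *ᵥ (w ∘ c.tree.edge)),
      c.gapGain (w ∘ c.tree.edge)) := rfl

/-- Error coordinates of a state of the closed loop. -/
def error (s : E.LoopState) : E.SyncError × (Fin 2 → ℝ) :=
  (((deviation c.qτ s.x, fun i => edgeDiff (E.nbrDart i) s.x - s.ζ i),
    edgeDiff c.tree.edge s.x - s.ζβ), s.zT)

theorem syncInput_eq (s : E.LoopState) :
    c.syncInput s = E.syncControl c.γs c.αs (c.error s).1.1 := by
  ext i
  rw [syncInput, error, syncControl_apply]
  congr 2
  ext a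
  rw [Finset.sum_apply]
  refine Finset.sum_congr rfl fun j _ => ?_
  simp only [fused, Pi.sub_apply, edgeDiff_apply, deviation_apply, nbrDart]
  ring

theorem deviation_stackA {q : Fin N → ℝ} (hq : ∑ i, q i = 1) (x : Fin 2 × Fin N → ℝ) :
    deviation q (stackA E.τ (Fin N) *ᵥ deviation q x) = deviation q (stackA E.τ (Fin N) *ᵥ x) := by
  ext ⟨a, i⟩
  simp only [deviation_apply, weighted_stackA, weighted_deviation hq, mulVec_zero, Pi.zero_apply,
    stackA_mulVec_apply, clockA_mulVec]
  fin_cases a <;> simp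
  ring

theorem deviation_stackB_add_const {q : Fin N → ℝ} (hq : ∑ i, q i = 1) (η : Fin N → ℝ) (r : ℝ) :
    deviation q (stackB E.τ (Fin N) *ᵥ fun i => η i + r)
      = deviation q (stackB E.τ (Fin N) *ᵥ η) := by
  have h : q ⬝ᵥ (fun i => η i + r) = q ⬝ᵥ η + r := by
    simp [dotProduct, mul_add, Finset.sum_add_distrib, ← Finset.sum_mul, hq]
  ext ⟨a, i⟩
  simp only [deviation_apply, weighted_stackB, h, stackB_mulVec_apply, Pi.smul_apply, smul_eq_mul]
  ring

/-- The floating input is common to all clocks, so it disappears from deviations and edge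
differences; synchronization and innovations depend only on differences, estimation errors and
noise. Hence the recursion closes. -/
theorem error_step (hq : ∑ i, c.qτ i = 1) (k : ℕ) (s : E.LoopState) (v : Fin 2 × Fin N → ℝ)
    (w : E.graph.Dart → ℝ) :
    c.error (c.step k s v w) = c.errorStep k (c.error s) + c.noiseMap (Sum.elim v w) := by
  rw [noiseMap_apply, errorStep_apply, syncErrorStep_apply]
  refine Prod.ext (Prod.ext (Prod.ext ?_ ?_) ?_) ?_
  · change deviation c.qτ (c.step k s v w).x = E.syncStep c.qτ c.γs c.αs (c.error s).1.1
      + deviation c.qτ v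
    simp only [step]
    rw [map_add, map_add, deviation_stackB_add_const hq, syncInput_eq, syncStep,
      LinearMap.comp_apply, LinearMap.add_apply, map_add, ← deviation_stackA hq]
    rfl
  · funext i
    exact edgeDiff_sub_estimatorStep _ _ _ _ _ _ _ _
  · exact edgeDiff_sub_estimatorStep _ _ _ _ _ _ _ _
  · change (c.step k s v w).zT = c.floatStep k s.zT
      + c.gapGain (stackC (Fin (N - 1)) *ᵥ (edgeDiff c.tree.edge s.x - s.ζβ))
      + c.gapGain (w ∘ c.tree.edge)
    have hf : clockA E.τ *ᵥ s.zT + c.floatInput k s • clockB E.τ = c.floatStep k s.zT := by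
      rw [floatStep, floatInput, toLin'_apply]
      split_ifs
      · rw [sub_mulVec, vecMulVec_mulVec]
        ext a
        simp only [Pi.add_apply, Pi.sub_apply, Pi.smul_apply, smul_eq_mul,
          MulOpposite.smul_eq_mul_unop, MulOpposite.unop_op]
        ring
      · simp
    rw [add_assoc, ← map_add, ← innovation_eq, ← hf]
    rfl

theorem error_loop {Ω : Type*} (hq : ∑ i, c.qτ i = 1) (v : ℕ → Ω → Fin 2 × Fin N → ℝ)
    (w : ℕ → Ω → E.graph.Dart → ℝ) (s₀ : E.LoopState) (k : ℕ) (ω : Ω) :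
    c.error (c.loop v w s₀ (k + 1) ω) = c.errorStep k (c.error (c.loop v w s₀ k ω))
      + c.noiseMap (Sum.elim (v k ω) (w k ω)) := by
  rw [loop, error_step c hq]

theorem dvd_reflect {l n j : ℕ} (hn : l ∣ n) (hj : j < n) : l ∣ n - 1 - j ↔ l ∣ j + 1 := by
  have h : n - 1 - j + (j + 1) = n := by omega
  rw [← h] at hn
  exact ⟨fun h1 => (Nat.dvd_add_right h1).1 hn, fun h1 => (Nat.dvd_add_left h1).1 hn⟩

theorem error_loop_eq {Ω : Type*} (hq : ∑ i, c.qτ i = 1) (v : ℕ → Ω → Fin 2 × Fin N → ℝ)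
    (w : ℕ → Ω → E.graph.Dart → ℝ) (s₀ : E.LoopState) (K : ℕ) (ω : Ω) :
    c.error (c.loop v w s₀ (K * c.ℓ) ω) = backwardFlow c.errorStep (K * c.ℓ) (c.error s₀)
      + ∑ j ∈ Finset.range (K * c.ℓ), backwardFlow c.errorStep j
        (c.noiseMap (Sum.elim (v (K * c.ℓ - 1 - j) ω) (w (K * c.ℓ - 1 - j) ω))) := by
  have h := eq_backwardFlow_add_sum (A := c.errorStep) (n := K * c.ℓ)
    (e := fun k => c.error (c.loop v w s₀ k ω))
    (u := fun k => c.noiseMap (Sum.elim (v k ω) (w k ω)))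
    (fun j hj => by
      simp only [errorStep, floatStep, dvd_reflect (Dvd.intro_left K rfl) hj])
    (fun k => c.error_loop hq v w s₀ k ω) le_rfl
  simpa [loop] using h

theorem floatStep_add_period (k : ℕ) : c.floatStep (k + c.ℓ) = c.floatStep k := by
  simp [floatStep]

theorem errorStep_add_period (k : ℕ) : c.errorStep (k + c.ℓ) = c.errorStep k := by
  simp [errorStep, floatStep_add_period]

end Controller
end ClockEnsemble

namespace ClockEnsemble

variable {N : ℕ} {E : ClockEnsemble N}

/-! ### The spanning tree -/

theorem SpanningTree.eq_of_incidence_mulVec_eq_zero (t : E.SpanningTree) {f : Fin N → ℝ}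
    (hf : incidence t.edge *ᵥ f = 0) (i j : Fin N) : f i = f j := by
  classical
  set G := SimpleGraph.fromEdgeSet (Set.range fun e => (t.edge e).edge)
  refine ((SimpleGraph.lapMatrix_mulVec_eq_zero_iff_forall_adj G).symm.trans
    (SimpleGraph.lapMatrix_mulVec_eq_zero_iff_forall_reachable G)).1 (fun i j hij => ?_) i j
    (t.isTree.connected.preconnected i j)
  rw [SimpleGraph.fromEdgeSet_adj] at hij
  obtain ⟨⟨e, he⟩, -⟩ := hij
  have h0 := congrFun hf e
  rw [incidence_mulVec, Pi.zero_apply, sub_eq_zero] at h0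
  have he' : s((t.edge e).fst, (t.edge e).snd) = s(i, j) := he
  rw [Sym2.eq_iff] at he'
  rcases he' with ⟨h1, h2⟩ | ⟨h1, h2⟩
  · rw [← h1, ← h2, h0]
  · rw [← h1, ← h2, h0]

section InducedInverse

variable {q : Fin N → ℝ} {t : E.SpanningTree} {Vp : Matrix (Fin N) (Fin (N - 1)) ℝ}

theorem incidence_mul_inducedInverse (h : IsInducedInverse q (incidence t.edge) Vp) :
    incidence t.edge * Vp = 1 := by
  obtain ⟨W, -, hdet, rfl⟩ := h
  rw [← Matrix.mul_assoc, mul_nonsing_inv _ hdet]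

theorem vecMul_inducedInverse (h : IsInducedInverse q (incidence t.edge) Vp) : q ᵥ* Vp = 0 := by
  obtain ⟨W, hW, -, rfl⟩ := h
  rw [← vecMul_vecMul, hW, zero_vecMul]

/-- `Vp V` is the projection along constants onto vectors of zero `q`-mean: the residual lies in the
kernel of `V`, which consists of constants on a tree, and its `q`-mean is that of `f`. -/
theorem inducedInverse_mulVec (hq : ∑ i, q i = 1)
    (h : IsInducedInverse q (incidence t.edge) Vp) (f : Fin N → ℝ) (i : Fin N) :
    (Vp *ᵥ (incidence t.edge *ᵥ f)) i = f i - q ⬝ᵥ f := by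
  set g := f - Vp *ᵥ (incidence t.edge *ᵥ f) with hg
  have hker : incidence t.edge *ᵥ g = 0 := by
    rw [hg, mulVec_sub, mulVec_mulVec, incidence_mul_inducedInverse h, one_mulVec, sub_self]
  have hc : q ⬝ᵥ g = g i := by
    simp only [dotProduct, t.eq_of_incidence_mulVec_eq_zero hker _ i]
    rw [← Finset.sum_mul, hq, one_mul]
  have hqg : q ⬝ᵥ g = q ⬝ᵥ f := by
    rw [hg, dotProduct_sub, dotProduct_mulVec, vecMul_inducedInverse h, zero_dotProduct, sub_zero]
  rw [← hqg, hc, hg]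
  simp

theorem vecMul_incidence_eq_zero (h : IsInducedInverse q (incidence t.edge) Vp)
    (y : Fin (N - 1) → ℝ) (hy : y ᵥ* incidence t.edge = 0) : y = 0 := by
  rw [← vecMul_one y, ← incidence_mul_inducedInverse h, ← vecMul_vecMul, hy, zero_vecMul]

theorem SpanningTree.edge_injective (h : IsInducedInverse q (incidence t.edge) Vp) :
    Function.Injective t.edge := by
  intro e e' hee
  by_contra hne
  have h1 : (incidence t.edge * Vp) e e' = (incidence t.edge * Vp) e' e' := by
    simp only [Matrix.mul_apply, incidence, of_apply, hee]
  rw [incidence_mul_inducedInverse h, one_apply_ne hne, one_apply_eq] at h1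
  exact zero_ne_one h1

end InducedInverse

namespace Controller

variable (c : E.Controller)

/-! ### The tracking error as an output of the error dynamics -/

/-- The tracking error of a clock in error coordinates. -/
def trackingOutput (i : Fin N) : (E.SyncError × (Fin 2 → ℝ)) →ₗ[ℝ] (Fin 2 → ℝ) :=
  (LinearMap.funLeft ℝ ℝ fun a => (a, i)) ∘ₗ LinearMap.fst ℝ _ _ ∘ₗ LinearMap.fst ℝ _ _ ∘ₗ
      LinearMap.fst ℝ _ _
    + weightedMap c.gapRow ∘ₗ LinearMap.snd ℝ _ _ ∘ₗ LinearMap.fst ℝ _ _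
    + LinearMap.snd ℝ _ _

theorem trackingOutput_apply (i : Fin N) (e : E.SyncError × (Fin 2 → ℝ)) (a : Fin 2) :
    c.trackingOutput i e a = e.1.1.1 (a, i) + weighted c.gapRow e.1.2 a + e.2 a := rfl

variable {c}

theorem gapRow_dotProduct (hqτ : ∑ i, c.qτ i = 1) (hqT : ∑ i, c.qT i = 1)
    (hVp : IsInducedInverse c.qT (incidence c.tree.edge) c.Vp) (f : Fin N → ℝ) :
    c.gapRow ⬝ᵥ (incidence c.tree.edge *ᵥ f) = c.qτ ⬝ᵥ f - c.qT ⬝ᵥ f := by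
  rw [gapRow, ← dotProduct_mulVec]
  conv_lhs => rw [dotProduct]
  simp only [inducedInverse_mulVec hqT hVp, mul_sub, Finset.sum_sub_distrib, ← Finset.sum_mul, hqτ,
    one_mul]
  rfl

theorem weighted_gapRow_edgeDiff (hqτ : ∑ i, c.qτ i = 1) (hqT : ∑ i, c.qT i = 1)
    (hVp : IsInducedInverse c.qT (incidence c.tree.edge) c.Vp) (x : Fin 2 × Fin N → ℝ) :
    weighted c.gapRow (edgeDiff c.tree.edge x) = weighted c.qτ x - weighted c.qT x := by
  ext a
  have := gapRow_dotProduct hqτ hqT hVp fun i => x (a, i)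
  have h2 : (fun e => edgeDiff c.tree.edge x (a, e))
      = incidence c.tree.edge *ᵥ fun i => x (a, i) := by
    ext e
    rw [incidence_mulVec, edgeDiff_apply]
  rw [← h2] at this
  exact this

/-- The reference differs from the `q_T`-weighted mean by the mismatch of the supervisor's
estimates. -/
theorem weighted_sub_freeRun {Ω : Type*} (hqτ : ∑ i, c.qτ i = 1) (hqT : ∑ i, c.qT i = 1)
    (hVp : IsInducedInverse c.qT (incidence c.tree.edge) c.Vp) {κ : ℝ}
    (hκ : ∀ i, c.qτ i * E.Γ E.τ i = κ) (v : ℕ → Ω → Fin 2 × Fin N → ℝ)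
    (w : ℕ → Ω → E.graph.Dart → ℝ) (s₀ : E.LoopState) (k : ℕ) (ω : Ω) :
    weighted c.qT (c.loop v w s₀ k ω).x - E.freeRun v c.qT (c.refInit s₀) k ω
      = (c.loop v w s₀ k ω).zT - weighted c.gapRow (c.loop v w s₀ k ω).ζβ := by
  induction k with
  | zero =>
    simp only [loop, freeRun, refInit]
    abel
  | succ k ih =>
    set s := c.loop v w s₀ k ω
    -- As `q_τ` does not see synchronization, the control enters the estimated gap with weight
    -- `-q_T`, which matches its effect on the `q_T`-mean.
    have hη : c.qτ ⬝ᵥ c.syncInput s = 0 := by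
      rw [syncInput_eq]
      exact E.dotProduct_syncControl hκ _ _ _ _
    have hsum : c.qT ⬝ᵥ (fun i => c.syncInput s i + c.floatInput k s)
        = c.qT ⬝ᵥ c.syncInput s + c.floatInput k s := by
      simp [dotProduct, mul_add, Finset.sum_add_distrib, ← Finset.sum_mul, hqT]
    rw [loop, freeRun]
    change weighted c.qT (stackA E.τ (Fin N) *ᵥ s.x + stackB E.τ (Fin N) *ᵥ
        (fun i => c.syncInput s i + c.floatInput k s) + v k ω) - _
      = clockA E.τ *ᵥ s.zT + c.floatInput k s • clockB E.τ
        + weighted c.gapRow (c.Hf *ᵥ innovation c.tree.edge s.ζβ s.x (w k ω))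
      - weighted c.gapRow (estimatorStep c.tree.edge c.Hf s.ζβ s.x (c.syncInput s) (w k ω))
    rw [estimatorStep, weighted_add, weighted_add, weighted_add, weighted_add, weighted_stackA,
      weighted_stackA, weighted_stackB, weighted_stackB, gapRow_dotProduct hqτ hqT hVp, hη, hsum]
    have hA := congrArg (clockA E.τ *ᵥ ·) ih
    simp only [mulVec_sub] at hA
    rw [zero_sub, neg_smul, add_smul]
    linear_combination (exp := 1) hA

/-- The error splits as deviation from the `q_τ`-mean, plus gap between the two means, plus
`q_T`-mean minus reference; the last two combine into the gap estimate and a tree estimation error.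
-/
theorem loop_sub_freeRun {Ω : Type*} (hqτ : ∑ i, c.qτ i = 1) (hqT : ∑ i, c.qT i = 1)
    (hVp : IsInducedInverse c.qT (incidence c.tree.edge) c.Vp) {κ : ℝ}
    (hκ : ∀ i, c.qτ i * E.Γ E.τ i = κ) (v : ℕ → Ω → Fin 2 × Fin N → ℝ)
    (w : ℕ → Ω → E.graph.Dart → ℝ) (s₀ : E.LoopState) (k : ℕ) (ω : Ω) (i : Fin N) (a : Fin 2) :
    (c.loop v w s₀ k ω).x (a, i) - E.freeRun v c.qT (c.refInit s₀) k ω a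
      = c.trackingOutput i (c.error (c.loop v w s₀ k ω)) a := by
  have h := congrFun (weighted_sub_freeRun hqτ hqT hVp hκ v w s₀ k ω) a
  have h2 := congrFun (weighted_gapRow_edgeDiff hqτ hqT hVp (c.loop v w s₀ k ω).x) a
  simp only [Pi.sub_apply] at h h2
  rw [trackingOutput_apply, error]
  simp only [weighted_sub, deviation_apply, Pi.sub_apply]
  rw [h2]
  linarith

end Controller

end ClockEnsemble

namespace ClockEnsemble

variable {N : ℕ} {E : ClockEnsemble N}

namespace Controller

variable {c : E.Controller}

/-! ### Stability of the error dynamics -/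

theorem syncErrorStep_stable (hq1 : ∑ i, c.qτ i = 1) {κ : ℝ} (hκ : ∀ i, c.qτ i * E.Γ E.τ i = κ)
    (hH : ∀ i, IsEdgeKalmanGain (E.nbrDart i) (c.H i)) (hHf : IsEdgeKalmanGain c.tree.edge c.Hf)
    (hVp : IsInducedInverse c.qT (incidence c.tree.edge) c.Vp)
    (hγs : 0 < c.γs ∧ c.γs < 4 / (2 + c.αs) * (lambdaMax E.scaledLaplacian)⁻¹)
    (hαs : 0 < c.αs) (e : E.SyncError) :
    Tendsto (fun k => (c.syncErrorStep ^ k) e) atTop (𝓝 0) := by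
  set L : (∀ i, Fin 2 × E.Nbr i → ℝ) →ₗ[ℝ] (∀ i, Fin 2 × E.Nbr i → ℝ) :=
    LinearMap.pi fun i => toLin' (stackA E.τ (E.Nbr i) - c.H i * stackC (E.Nbr i)) ∘ₗ
      LinearMap.proj i with hL
  have hLpow : ∀ k ε i, (L ^ k) ε i
      = (toLin' (stackA E.τ (E.Nbr i) - c.H i * stackC (E.Nbr i)) ^ k) (ε i) := by
    intro k ε i
    induction k with
    | zero => rfl
    | succ k ih =>
      rw [pow_succ', pow_succ', Module.End.mul_apply, Module.End.mul_apply, ← ih]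
      rfl
  have hLst : ∀ ε, Tendsto (fun k => (L ^ k) ε) atTop (𝓝 0) := fun ε => by
    rw [tendsto_pi_nhds]
    intro i
    simp only [hLpow]
    exact (hH i).stable (E.nbrDart_vecMul_incidence i) (ε i)
  set x : ℕ → E.SyncError := fun k => (c.syncErrorStep ^ k) e with hx
  have hxs : ∀ k, x (k + 1) = c.syncErrorStep (x k) := fun k => by
    simp only [hx, pow_succ', Module.End.mul_apply]
  have h2 : Tendsto (fun k => (x k).2) atTop (𝓝 0) := by
    refine (hHf.stable (vecMul_incidence_eq_zero hVp) e.2).congr fun k => ?_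
    induction k with
    | zero => rfl
    | succ k ih =>
      rw [hxs, pow_succ', Module.End.mul_apply, ih]
      rfl
  have h12' : ∀ k, (x k).1.2 = (L ^ k) e.1.2 := fun k => by
    induction k with
    | zero => rfl
    | succ k ih =>
      rw [hxs, pow_succ', Module.End.mul_apply, ← ih]
      rfl
  have h12s : Summable fun k => ‖(x k).1.2‖ := by
    obtain ⟨b, hb, -, hbL⟩ := exists_summable_bound_pow hLst
    simp only [h12']
    exact Summable.of_nonneg_of_le (fun _ => norm_nonneg _) (fun k => hbL k _) (hb.mul_right _)
  have h12 : Tendsto (fun k => (x k).1.2) atTop (𝓝 0) :=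
    tendsto_zero_iff_norm_tendsto_zero.2 h12s.tendsto_atTop_zero
  have h11 : Tendsto (fun k => (x k).1.1) atTop (𝓝 0) := by
    refine tendsto_zero_iff_norm_tendsto_zero.2 (Summable.tendsto_atTop_zero ?_)
    refine summable_norm_of_stable (E.syncStep_stable hq1 hκ hαs hγs)
      (u := fun k => (E.syncStep c.qτ c.γs c.αs ∘ₗ LinearMap.inr ℝ _ _) (x k).1.2) (fun k => ?_)
      (summable_norm_map _ h12s)
    rw [hxs, syncErrorStep_apply, LinearMap.comp_apply, LinearMap.comp_apply, ← map_add]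
    simp
  exact (h11.prodMk_nhds h12).prodMk_nhds h2

theorem fst_backwardFlow (i : ℕ) (e : E.SyncError × (Fin 2 → ℝ)) :
    (backwardFlow c.errorStep i e).1 = (c.syncErrorStep ^ i) e.1 := by
  induction i generalizing e with
  | zero => rfl
  | succ i ih =>
    rw [backwardFlow, LinearMap.comp_apply, ih, pow_succ]
    rfl

/-- Without an error of the supervisor's edge-state estimate, the estimate of the gap evolves
autonomously. -/
theorem snd_backwardFlow (i : ℕ) (e : E.SyncError × (Fin 2 → ℝ)) (he : e.1.2 = 0) :
    (backwardFlow c.errorStep i e).2 = backwardFlow c.floatStep i e.2 := by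
  induction i generalizing e with
  | zero => rfl
  | succ i ih =>
    rw [backwardFlow, backwardFlow, LinearMap.comp_apply, LinearMap.comp_apply, ih]
    · rw [errorStep_apply, he, mulVec_zero, map_zero, add_zero]
    · rw [errorStep_apply, syncErrorStep_apply]
      simp [he]

theorem backwardFlow_floatStep_of_lt {i : ℕ} (hi : i < c.ℓ) :
    backwardFlow c.floatStep i = toLin' (clockA (i * E.τ)) := by
  induction i with
  | zero =>
    refine LinearMap.ext fun z => ?_
    ext a
    simp only [backwardFlow, toLin'_apply, clockA_mulVec]
    fin_cases a <;> simp
  | succ i ih =>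
    have hnd : ¬ c.ℓ ∣ i + 1 := Nat.not_dvd_of_pos_of_lt (Nat.succ_pos i) hi
    rw [backwardFlow, ih (by omega), floatStep, if_neg hnd]
    refine LinearMap.ext fun z => ?_
    ext a
    simp only [LinearMap.comp_apply, toLin'_apply, clockA_mulVec]
    fin_cases a <;> simp
    ring

/-- Over one long period, floating acts as a static state feedback of a clock sampled with the long
period. -/
theorem backwardFlow_floatStep_period (hl : 1 ≤ c.ℓ) :
    backwardFlow c.floatStep c.ℓ = toLin' (feedbackMatrix c.γf c.αf c.T) := by
  obtain ⟨p, hp⟩ : ∃ p, c.ℓ = p + 1 := ⟨c.ℓ - 1, by omega⟩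
  have hT : c.T = (p + 1) * E.τ := by rw [T, hp]; push_cast; ring
  -- The controlled step comes first in each long period and `ℓ - 1` free steps follow; they carry
  -- `B` at period `τ` to `B` at period `T`.
  rw [hp, backwardFlow, backwardFlow_floatStep_of_lt (by omega), floatStep, ← hp,
    if_pos dvd_rfl, feedbackMatrix]
  refine LinearMap.ext fun z => ?_
  simp only [LinearMap.comp_apply, toLin'_apply, sub_mulVec, vecMulVec_mulVec, clockA_mulVec]
  set f := gainRow c.γf c.αf c.T ⬝ᵥ z
  ext a
  fin_cases a <;> simp [clockB, hT]
  ring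

/-- Sampled once per long period, the gap estimate is a stable system driven by finitely many
subsequences of a summable input. -/
theorem errorStep_monodromy_stable (hl : 1 ≤ c.ℓ)
    (hsub : ∀ e, Tendsto (fun k => (c.syncErrorStep ^ k) e) atTop (𝓝 0))
    (hfl : ∀ z, Tendsto (fun k => (toLin' (feedbackMatrix c.γf c.αf c.T) ^ k) z) atTop (𝓝 0))
    (e : E.SyncError × (Fin 2 → ℝ)) :
    Tendsto (fun K => (backwardFlow c.errorStep c.ℓ ^ K) e) atTop (𝓝 0) := by
  let u : ℕ → E.SyncError × (Fin 2 → ℝ) := fun k => Nat.rec e (fun k s => c.errorStep k s) k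
  have hu : ∀ k, u (k + 1) = c.errorStep k (u k) := fun k => rfl
  have hmono : ∀ K, (backwardFlow c.errorStep c.ℓ ^ K) e = u (K * c.ℓ) := fun K => by
    have := eq_backwardFlow_add_sum (A := c.errorStep) (n := K * c.ℓ) (e := u) (u := fun _ => 0)
      (fun j hj => by
        simp only [errorStep, floatStep, dvd_reflect (Dvd.intro_left K rfl) hj])
      (fun k => by rw [hu, add_zero]) le_rfl
    rw [this, backwardFlow_mul c.errorStep_add_period]
    simp [u]
  have h1 : ∀ k, (u k).1 = (c.syncErrorStep ^ k) e.1 := fun k => by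
    induction k with
    | zero => rfl
    | succ k ih =>
      rw [hu, pow_succ', Module.End.mul_apply, ← ih]
      rfl
  have hKl : Tendsto (fun K : ℕ => K * c.ℓ) atTop atTop :=
    tendsto_id.atTop_mul_const' (by omega)
  set p : ℕ → Fin 2 → ℝ := fun k =>
    (c.gapGain ∘ₗ toLin' (stackC (Fin (N - 1))) ∘ₗ LinearMap.snd ℝ _ _) (u k).1 with hp
  have hps : Summable fun k => ‖p k‖ := by
    obtain ⟨b, hb, -, hbL⟩ := exists_summable_bound_pow hsub
    refine summable_norm_map _ ?_
    simp only [h1]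
    exact Summable.of_nonneg_of_le (fun _ => norm_nonneg _) (fun k => hbL k _) (hb.mul_right _)
  have hz : ∀ k, (u (k + 1)).2 = c.floatStep k (u k).2 + p k := fun k => rfl
  have hblock : ∀ K, (u ((K + 1) * c.ℓ)).2
      = toLin' (feedbackMatrix c.γf c.αf c.T) (u (K * c.ℓ)).2
        + ∑ j ∈ Finset.range c.ℓ, backwardFlow c.floatStep j (p ((K + 1) * c.ℓ - 1 - j)) :=
    fun K => by
      have := eq_backwardFlow_add_sum (A := c.floatStep) (n := (K + 1) * c.ℓ)
        (e := fun k => (u k).2) (u := p) (i := c.ℓ)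
        (fun j hj => by simp only [floatStep, dvd_reflect (Dvd.intro_left (K + 1) rfl) hj])
        hz (Nat.le_mul_of_pos_left _ (Nat.succ_pos K))
      rw [backwardFlow_floatStep_period hl,
        show (K + 1) * c.ℓ - c.ℓ = K * c.ℓ by rw [add_mul, one_mul, Nat.add_sub_cancel]] at this
      exact this
  have hz0 : Tendsto (fun K => (u (K * c.ℓ)).2) atTop (𝓝 0) := by
    refine tendsto_zero_iff_norm_tendsto_zero.2 (Summable.tendsto_atTop_zero ?_)
    refine summable_norm_of_stable hfl hblock ?_
    refine Summable.of_nonneg_of_le (fun _ => norm_nonneg _) (fun K => norm_sum_le _ _) ?_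
    refine summable_sum fun j hj => summable_norm_map _ (hps.comp_injective
      (i := fun K => (K + 1) * c.ℓ - 1 - j) fun K K' hK => ?_)
    have hj' := Finset.mem_range.1 hj
    have e1 : c.ℓ ≤ (K + 1) * c.ℓ := Nat.le_mul_of_pos_left _ (Nat.succ_pos K)
    have e2 : c.ℓ ≤ (K' + 1) * c.ℓ := Nat.le_mul_of_pos_left _ (Nat.succ_pos K')
    have e3 : (K + 1) * c.ℓ = (K' + 1) * c.ℓ := by
      simp only at hK
      omega
    exact Nat.succ_injective (Nat.eq_of_mul_eq_mul_right hl e3)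
  simp only [hmono]
  have hsub0 : Tendsto (fun K => (u (K * c.ℓ)).1) atTop (𝓝 0) :=
    ((hsub e.1).comp hKl).congr fun K => (h1 _).symm
  exact hsub0.prodMk_nhds hz0

/-! ### Tracking of the reference -/

variable {Ω : Type*} {v : ℕ → Ω → Fin 2 × Fin N → ℝ} {w : ℕ → Ω → E.graph.Dart → ℝ}

theorem trackingError_eq (hqτ : ∑ i, c.qτ i = 1) (hqT : ∑ i, c.qT i = 1)
    (hVp : IsInducedInverse c.qT (incidence c.tree.edge) c.Vp) {κ : ℝ}
    (hκ : ∀ i, c.qτ i * E.Γ E.τ i = κ) (s₀ : E.LoopState) (i : Fin N) (K : ℕ) (ω : Ω) :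
    (fun a => (c.loop v w s₀ (K * c.ℓ) ω).x (a, i)
        - E.freeRun v c.qT (c.refInit s₀) (K * c.ℓ) ω a)
      = c.trackingOutput i (backwardFlow c.errorStep (K * c.ℓ) (c.error s₀))
        + ∑ j ∈ Finset.range (K * c.ℓ), (c.trackingOutput i ∘ₗ backwardFlow c.errorStep j ∘ₗ
          c.noiseMap) (Sum.elim (v (K * c.ℓ - 1 - j) ω) (w (K * c.ℓ - 1 - j) ω)) := by
  ext a
  rw [loop_sub_freeRun hqτ hqT hVp hκ, error_loop_eq c hqτ, map_add, map_sum]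
  rfl

variable [MeasurableSpace Ω] {μ : Measure Ω} [IsProbabilityMeasure μ]

theorem tracks_of_stable (hnoise : E.IsNoise μ v w) (hl : 1 ≤ c.ℓ)
    (hqτ : ∑ i, c.qτ i = 1) (hqT : ∑ i, c.qT i = 1)
    (hVp : IsInducedInverse c.qT (incidence c.tree.edge) c.Vp) {κ : ℝ}
    (hκ : ∀ i, c.qτ i * E.Γ E.τ i = κ)
    (hst : ∀ e, Tendsto (fun K => (backwardFlow c.errorStep c.ℓ ^ K) e) atTop (𝓝 0))
    (s₀ : E.LoopState) : c.Tracks μ v w s₀ := fun i => by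
  obtain ⟨b, hb, -, hbL⟩ := exists_summable_bound_backwardFlow c.errorStep_add_period hst
  refine hnoise.joint.isSteadyStationaryGaussian hl
    (trackingError_eq hqτ hqT hVp hκ s₀ i) ?_ fun x => ?_
  · simp only [backwardFlow_mul c.errorStep_add_period]
    have := ((c.trackingOutput i).continuous_of_finiteDimensional.tendsto 0).comp
      (hst (c.error s₀))
    rwa [map_zero] at this
  · exact summable_norm_map (c.trackingOutput i) (Summable.of_nonneg_of_le
      (fun _ => norm_nonneg _) (fun k => hbL k (c.noiseMap x)) (hb.mul_right _))

/-- Tracking forces the response of the noise-free error dynamics and the response to each noise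
impulse to vanish. -/
theorem Tracks.tendsto_zero (hnoise : E.IsNoise μ v w) (hl : 1 ≤ c.ℓ)
    (hqτ : ∑ i, c.qτ i = 1) (hqT : ∑ i, c.qT i = 1)
    (hVp : IsInducedInverse c.qT (incidence c.tree.edge) c.Vp) {κ : ℝ}
    (hκ : ∀ i, c.qτ i * E.Γ E.τ i = κ) {s₀ : E.LoopState} (h : c.Tracks μ v w s₀) (i : Fin N) :
    Tendsto (fun K => c.trackingOutput i (backwardFlow c.errorStep (K * c.ℓ) (c.error s₀))) atTop
        (𝓝 0) ∧
      ∀ x, Tendsto (fun j => c.trackingOutput i (backwardFlow c.errorStep j (c.noiseMap x))) atTop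
        (𝓝 0) :=
  hnoise.joint.tendsto_zero_of_isSteadyStationaryGaussian E.noiseCov_pos hl
    (trackingError_eq hqτ hqT hVp hκ s₀ i) (h i)

theorem floating_stable_of_initial_responses (hl : 1 ≤ c.ℓ) (i : Fin N)
    (h : ∀ s₀, Tendsto (fun K => c.trackingOutput i (backwardFlow c.errorStep (K * c.ℓ)
      (c.error s₀))) atTop (𝓝 0)) (z : Fin 2 → ℝ) :
    Tendsto (fun k => (toLin' (feedbackMatrix c.γf c.αf c.T) ^ k) z) atTop (𝓝 0) := by
  -- This start, inconsistent when `z ≠ 0`, excites the gap estimate alone.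
  refine (h ⟨0, 0, 0, z⟩).congr fun K => ?_
  have herr : c.error ⟨0, 0, 0, z⟩ = (0, z) := by
    refine Prod.ext (Prod.ext (Prod.ext ?_ ?_) ?_) rfl
    · exact map_zero _
    · funext j
      simp [error]
    · simp [error]
  have h1 := fst_backwardFlow (c := c) (K * c.ℓ) (0, z)
  have h2 := snd_backwardFlow (c := c) (K * c.ℓ) (0, z) rfl
  rw [map_zero] at h1
  ext a
  rw [herr, trackingOutput_apply, h1, h2, backwardFlow_mul c.floatStep_add_period,
    backwardFlow_floatStep_period hl, ← weightedMap_apply]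
  simp

theorem floating_stable_of_noise_responses (hl : 2 ≤ c.ℓ)
    (hqτ : ∑ i, c.qτ i = 1) (hqT : ∑ i, c.qT i = 1) (hne : c.qτ ≠ c.qT)
    (hHf : IsEdgeKalmanGain c.tree.edge c.Hf)
    (hVp : IsInducedInverse c.qT (incidence c.tree.edge) c.Vp)
    (hsub : ∀ e, Tendsto (fun k => (c.syncErrorStep ^ k) e) atTop (𝓝 0)) (i : Fin N)
    (h : ∀ x, Tendsto (fun j => c.trackingOutput i (backwardFlow c.errorStep j (c.noiseMap x)))
      atTop (𝓝 0)) (z : Fin 2 → ℝ) :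
    Tendsto (fun k => (toLin' (feedbackMatrix c.γf c.αf c.T) ^ k) z) atTop (𝓝 0) := by
  have hgap : c.gapRow ≠ 0 := fun h0 => hne (by
    ext j
    have := gapRow_dotProduct hqτ hqT hVp (Pi.single j 1)
    rw [h0, zero_dotProduct, dotProduct_single, dotProduct_single, mul_one, mul_one] at this
    linarith)
  have hflow : ∀ y, Tendsto (fun j => backwardFlow c.floatStep j (c.gapGain y)) atTop (𝓝 0) := by
    intro y
    -- The process noise is chosen so that the true tree edges jump exactly as the measurement noise
    -- `y` moves their estimates: no tree estimation error arises, but the gap estimate is kicked.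
    set v₀ : Fin 2 × Fin N → ℝ := fun p => (c.Vp *ᵥ fun e => (c.Hf *ᵥ y) (p.1, e)) p.2 with hv₀
    set w₀ : E.graph.Dart → ℝ := Function.extend c.tree.edge y 0
    have hw₀ : w₀ ∘ c.tree.edge = y := by
      ext e
      exact (SpanningTree.edge_injective hVp).extend_apply y 0 e
    have hdiff : edgeDiff c.tree.edge v₀ = c.Hf *ᵥ y := by
      ext ⟨a, e⟩
      have : incidence c.tree.edge *ᵥ (c.Vp *ᵥ fun e => (c.Hf *ᵥ y) (a, e))
          = fun e => (c.Hf *ᵥ y) (a, e) := by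
        rw [mulVec_mulVec, incidence_mul_inducedInverse hVp, one_mulVec]
      have h1 := congrFun this e
      rw [incidence_mulVec] at h1
      exact h1
    set e₀ := c.noiseMap (Sum.elim v₀ w₀) with he₀
    have h12 : e₀.1.2 = 0 := by
      rw [he₀, noiseMap_apply]
      simp only [hw₀, hdiff, sub_self]
    have h2 : e₀.2 = c.gapGain y := by rw [he₀, noiseMap_apply, hw₀]
    set D : E.SyncError →ₗ[ℝ] (Fin 2 → ℝ) :=
      c.trackingOutput i ∘ₗ LinearMap.inl ℝ _ _
    have hD := (D.continuous_of_finiteDimensional.tendsto 0).comp (hsub e₀.1)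
    rw [map_zero] at hD
    have := (h (Sum.elim v₀ w₀)).sub hD
    rw [sub_zero] at this
    refine this.congr fun j => ?_
    ext a
    simp only [Pi.sub_apply, Function.comp_apply, D, LinearMap.comp_apply, LinearMap.inl_apply,
      trackingOutput_apply, ← he₀]
    rw [snd_backwardFlow j e₀ h12, fst_backwardFlow, h2]
    simp
  obtain ⟨y, hy⟩ := hHf.exists_ne_zero (vecMul_incidence_eq_zero hVp) hgap
  set g := c.gapGain y with hg
  have hg1 : g 1 ≠ 0 := hy
  set Φ := toLin' (feedbackMatrix c.γf c.αf c.T)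
  have hKl : Tendsto (fun K : ℕ => K * c.ℓ) atTop atTop :=
    tendsto_id.atTop_mul_const' (by omega)
  have h0 : Tendsto (fun K => (Φ ^ K) g) atTop (𝓝 0) := by
    refine ((hflow y).comp hKl).congr fun K => ?_
    rw [Function.comp_apply, backwardFlow_mul c.floatStep_add_period,
      backwardFlow_floatStep_period (by omega)]
  -- A kick of age `Kℓ + 1` makes one uncontrolled step first, which requires `ℓ ≥ 2`. Since `g 1 ≠
  -- 0`, the vectors `g` and `A g` span the plane.
  have h1 : Tendsto (fun K => (Φ ^ K) (clockA E.τ *ᵥ g)) atTop (𝓝 0) := by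
    refine ((hflow y).comp ((tendsto_add_atTop_nat 1).comp hKl)).congr fun K => ?_
    simp only [Function.comp_apply]
    rw [backwardFlow_mul_add c.floatStep_add_period, backwardFlow_floatStep_period (by omega),
      backwardFlow_floatStep_of_lt (by omega)]
    simp
    rfl
  have hz : z = (z 1 / g 1) • g
      + ((z 0 - z 1 / g 1 * g 0) / (E.τ * g 1)) • (clockA E.τ *ᵥ g - g) := by
    have hτ := E.τ_pos.ne'
    have hd : clockA E.τ *ᵥ g - g = ![E.τ * g 1, 0] := by
      rw [clockA_mulVec]
      ext a
      rw [Pi.sub_apply]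
      fin_cases a <;> simp
    rw [hd]
    ext a
    fin_cases a
    · simp
      field_simp
      ring
    · simp [hg1]
  rw [hz]
  simp only [map_add, map_smul, map_sub]
  simpa using (h0.const_smul (z 1 / g 1)).add
    ((h1.sub h0).const_smul ((z 0 - z 1 / g 1 * g 0) / (E.τ * g 1)))

end Controller

end ClockEnsemble

end

theorem theorem3 {Ω : Type*} [MeasurableSpace Ω] (μ : Measure Ω) [IsProbabilityMeasure μ]
    {N : ℕ} (hN : 2 ≤ N) (E : ClockEnsemble N)
    (v : ℕ → Ω → Fin 2 × Fin N → ℝ) (w : ℕ → Ω → E.graph.Dart → ℝ) (hnoise : E.IsNoise μ v w)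
    (c : E.Controller) (hℓ : 1 ≤ c.ℓ)
    (hqτ : E.IsAllanOptimal μ v 1 c.qτ) (hqT : E.IsAllanOptimal μ v c.ℓ c.qT)
    (hH : ∀ i, ClockEnsemble.IsEdgeKalmanGain (E.nbrDart i) (c.H i))
    (hHf : ClockEnsemble.IsEdgeKalmanGain c.tree.edge c.Hf)
    (hVp : IsInducedInverse c.qT (ClockEnsemble.incidence c.tree.edge) c.Vp)
    (hγs : 0 < c.γs ∧ c.γs < 4 / (2 + c.αs) * (lambdaMax E.scaledLaplacian)⁻¹)
    (hαs : 0 < c.αs) :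
    ((∀ s₀ : E.LoopState, c.Tracks μ v w s₀) ↔
      (0 < c.γf ∧ c.γf < 4 / (2 + c.αf)) ∧ 0 < c.αf) ∧
    (c.qτ ≠ c.qT → ∀ s₀ : E.LoopState,
      (c.Tracks μ v w s₀ ↔ (0 < c.γf ∧ c.γf < 4 / (2 + c.αf)) ∧ 0 < c.αf)) := by
  have hτopt := fun i => ClockEnsemble.IsAllanOptimal.eq hnoise.process le_rfl hqτ i
  simp only [Nat.cast_one, one_mul] at hτopt
  have hκ : ∀ i, c.qτ i * E.Γ E.τ i = (∑ j, (E.Γ E.τ j)⁻¹)⁻¹ := fun i => by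
    rw [hτopt, mul_assoc, inv_mul_cancel₀ (E.Γ_pos E.τ_pos i).ne', mul_one]
  have hT : 0 < c.T := mul_pos (by exact_mod_cast hℓ) E.τ_pos
  have hsub := ClockEnsemble.Controller.syncErrorStep_stable hqτ.1 hκ hH hHf hVp hγs hαs
  have hsuff : (0 < c.γf ∧ c.γf < 4 / (2 + c.αf)) ∧ 0 < c.αf → ∀ s₀, c.Tracks μ v w s₀ :=
    fun h => ClockEnsemble.Controller.tracks_of_stable hnoise hℓ hqτ.1 hqT.1 hVp hκ
      (ClockEnsemble.Controller.errorStep_monodromy_stable hℓ hsub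
        (feedbackMatrix_stable hT h.1.1 h.1.2 h.2))
  let i : Fin N := ⟨0, by omega⟩
  refine ⟨⟨fun h => ?_, hsuff⟩, fun hne s₀ => ⟨fun h => ?_, fun h => hsuff h s₀⟩⟩
  · exact gain_bounds_of_feedbackMatrix_stable hT
      (ClockEnsemble.Controller.floating_stable_of_initial_responses hℓ i fun s₀ =>
        ((h s₀).tendsto_zero hnoise hℓ hqτ.1 hqT.1 hVp hκ i).1)
  -- For `ℓ = 1` both weight vectors minimize the same Allan variance, whose minimizer is unique.
  · have hl2 : 2 ≤ c.ℓ := by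
      by_contra hlt
      have hl1 : c.ℓ = 1 := by omega
      rw [hl1] at hqT
      refine hne (funext fun j => ?_)
      rw [hτopt, ClockEnsemble.IsAllanOptimal.eq hnoise.process le_rfl hqT]
      simp
    exact gain_bounds_of_feedbackMatrix_stable hT
      (ClockEnsemble.Controller.floating_stable_of_noise_responses hl2 hqτ.1 hqT.1 hne hHf hVp hsub
        i (h.tendsto_zero hnoise hℓ hqτ.1 hqT.1 hVp hκ i).2)
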